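/- Let $\mathbb{F}_q$ be a finite field of characteristic $2$, let $K$ be a function field over $\mathbb{F}_q$ (a finite extension of a rational function field $\mathbb{F}_q(t)$), let $\infty$ be a rational place of $K$ (a place of degree one over $\mathbb{F}_q$), and let $A$ be the ring of elements of $K$ that are integral at every place other than $\infty$. Fix a uniformizer $\pi\in K$ at $\infty$. For $d\ge 0$ let $A_{d+}$ be the set of monic elements of degree $d$ in $A$, i.e. of those $a\in A$ having a pole of order $d$ at $\infty$ and leading coefficient $1$ with respect to $\pi$ (equivalently, $a\pi^d\equiv 1$ modulo the maximal ideal at $\infty$). Let $v$ be a prime of $A$, i.e. a place of $K$ different from $\infty$, and let $K_v$ be the completion of $K$ at $v$. For $k\in\mathbb{Z}$ and $d\ge 0$ put $$\widetilde S_d(k):=\sum_{\substack{a\in A_{d+}\\ v\nmid a}}\frac1{a^k}\in K,$$ and for a tuple $\mathbf{s}=(s_1,\dots,s_r)$ of integers put $$\zeta_v(\mathbf{s}):=\sum_{d_1>\cdots>d_r\ge 0}\widetilde S_{d_1}(s_1)\cdots\widetilde S_{d_r}(s_r)\in K_v .$$ The sets $A_{d+}$ are finite, and the series defining $\zeta_v(\mathbf{s})$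 is (unconditionally) summable in $K_v$ for every tuple $\mathbf{s}$ of integers. Let $n\ge1$, and let $s_1,\dots,s_n\in\mathbb{Z}$ and $k_1,\dots,k_n\ge1$ be integers such that each $s_i$ is $q$-even, i.e. $(q-1)\mid s_i$, and such that the integers $s_i$ ($1\le i\le n$) together with the integers $2s_i$ (for those $i$ with $k_i>1$) are all distinct. Put $\phi:=\sum_{i=1}^n k_i$ and, writing $(a)_j$ for a list of $j$ copies of $a$, $$\mathbf{s}_0:=((s_1)_{k_1},\dots,(s_n)_{k_n}),$$ and for each $i$ with $k_i>1$ $$\mathbf{s}_i:=((s_1)_{k_1},\dots,(s_i)_{k_i-2},2s_i,\dots,(s_n)_{k_n}),$$ i.e. $\mathbf{s}_i$ is $\mathbf{s}_0$ with two copies of $s_i$ replaced by one entry $2s_i$. Let $\mathbf{L}_0$, resp. $\mathbf{L}_i$, be the set of all distinct re-orderings of $\mathbf{s}_0$, resp. $\mathbf{s}_i$. Then, in $K_v$, $$\sum_{i:\,k_i>1}\ \sum_{\mathbf{w}\in\mathbf{L}_i}\zeta_v(\mathbf{w})\;+\;\phi\sum_{\mathbf{w}\in\mathbf{L}_0}\zeta_v(\mathbf{w})=0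 .$$ -/

import Mathlib

noncomputable section

/-- A place (prime) of a function field `K` over the constant field `F`: a discrete valuation ring
of `K` containing `F` (its fraction field is automatically `K`). -/
@[ext]
structure Place (F K : Type*) [Field F] [Field K] [Algebra F K] where
  ring : ValuationSubring K
  algebraMap_mem : ∀ c : F, algebraMap F K c ∈ ring
  isDVR : IsDiscreteValuationRing ring

namespace Place

variable {F K : Type*} [Field F] [Field K] [Algebra F K]

/-- The valuation of `K` attached to a place, written multiplicatively:
`P.val x ≤ 1` iff `x` lies in the valuation ring, `P.val x < 1` iff `x` lies in the maximal ideal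
of the valuation ring. -/
abbrev val (P : Place F K) : Valuation K P.ring.ValueGroup := P.ring.valuation

/-- The place is rational (of degree one): every residue class is represented by a constant. -/
def IsRational (P : Place F K) : Prop :=
  ∀ x : K, P.val x ≤ 1 → ∃ c : F, P.val (x - algebraMap F K c) < 1

/-- The completion `K_P` of `K` at the place `P`. -/
abbrev Completion (P : Place F K) : Type _ := P.val.Completion

/-- The embedding of `K` into its completion at `P`. -/
def toCompletion (P : Place F K) (x : K) : P.Completion :=
  ((WithVal.toVal P.val x : WithVal P.val) : P.Completion)

/-- The ring `A` of elements of `K` which are integral at all places different from `infty`. -/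
def integralOutside (infty : Place F K) : Subring K :=
  ⨅ (w : Place F K) (_ : w ≠ infty), w.ring.toSubring

/-- `A_{d+}`, the monic elements of degree `d` of the ring `A` of elements integral outside the
rational place `infty`. The sign is normalized by the uniformizer `π` at `infty`:
`a` is monic of degree `d` iff `a = π ^ (-d) * u` with `u ≡ 1` modulo the maximal ideal of `infty`,
i.e. iff `a` has a pole of order exactly `d` at `infty` and its leading coefficient with respect
to `π` is `1`. -/
def monics (infty : Place F K) (π : infty.ring) (d : ℕ) : Set K :=
  {a : K | a ∈ integralOutside infty ∧ infty.val (a * (π : K) ^ d - 1) < 1}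

/-- The power sum `S̃_d(k)`: the sum of `1 / a ^ k` over all monic `a ∈ A` of degree `d`
which are not divisible by the prime `v`. -/
def powerSum (infty : Place F K) (π : infty.ring) (v : Place F K) (d : ℕ) (k : ℤ) : K :=
  ∑ᶠ a ∈ {a : K | a ∈ monics infty π d ∧ v.val a = 1}, (a ^ k)⁻¹

/-- The term `S̃_{d_1}(s_1) ⋯ S̃_{d_r}(s_r) ∈ K_v` attached to `d_1 > ⋯ > d_r ≥ 0`. -/
def mzvTerm (infty : Place F K) (π : infty.ring) (v : Place F K) (s : List ℤ)
    (d : {d : Fin s.length → ℕ // StrictAnti d}) : v.Completion :=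
  ∏ j : Fin s.length, v.toCompletion (powerSum infty π v (d.1 j) (s.get j))

/-- The interpolated `v`-adic multiple zeta value `ζ_v(s_1, …, s_r) ∈ K_v`. -/
def mzv (infty : Place F K) (π : infty.ring) (v : Place F K) (s : List ℤ) : v.Completion :=
  ∑' d : {d : Fin s.length → ℕ // StrictAnti d}, mzvTerm infty π v s d

end Place

/-- The tuple `((s_1)_{k_1}, …, (s_n)_{k_n})`, where `(a)_j` denotes `j` copies of `a`. -/
def baseTuple {n : ℕ} (s : Fin n → ℤ) (k : Fin n → ℕ) : List ℤ :=
  (List.ofFn fun j => List.replicate (k j) (s j)).flatten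

/-- The tuple `((s_1)_{k_1}, …, (s_i)_{k_i - 2}, 2 s_i, …, (s_n)_{k_n})`
(only used when `k_i > 1`). -/
def mergedTuple {n : ℕ} (s : Fin n → ℤ) (k : Fin n → ℕ) (i : Fin n) : List ℤ :=
  (List.ofFn fun j =>
    if j = i then List.replicate (k j - 2) (s j) ++ [2 * s j]
    else List.replicate (k j) (s j)).flatten

/-- The set of all distinct re-orderings of a tuple. -/
def reorderings (l : List ℤ) : Finset (List ℤ) := l.permutations.toFinset

end

/-! Write `x d a` for the power sum of degree `d` and exponent `a`, `P_D(a)` for the sum of `x d a`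
over `d < D`, and `Sym_D(m)` for the sum of the truncated multiple sums over all orderings of a
multiset `m`. Take `m` to be the multiset of `baseTuple` and expand the sum of `P_D(a) * Sym_D(m -
a)` over the distinct `a` in `m`. Inserting `a` at a new index produces every ordering of `m` once
for each of its `φ` positions. The remaining terms put `a` on an index already carrying some `b`.
For `a ≠ b` such a term occurs twice and cancels in characteristic 2; for `a = b` Frobenius gives `x
d a ^ 2 = x d (2 * a)`, which yields the merged tuples. Distinctness of the doubled entries makes
each merged ordering occur exactly once. This finite identity is `sum_symSum_erase`.

It remains to see that `P_D(a)` tends to 0 at `v`. Since `a` is `q`-even and `q - 1 = 1` in the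
field, `P_D(a)` is also the sum of `b ^ (-a)` over all `v`-units `b` of degree `< D`, monic or not
(`sum_powerSum_eq`). That set is stable under translation by any `w` of degree `< D` divisible by
`v`. Pairing `b` with `b + w` shows that the sum is divisible by `w` (`val_sum_inv_zpow_le`), and
`w` may be taken highly divisible by `v` once `D` is large. The same pairing on monic elements makes
each power sum small, whence summability.

These arguments need three facts about `A`: its graded pieces are finite, a nonzero element cannot
vanish at `∞`, and it contains nonzero elements vanishing at `v`. They follow from the existence of
zeros of transcendental elements and from a Riemann-type dimension count. -/

section FunctionFieldPlaces

open Polynomial IntermediateField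
open scoped IntermediateField.algebraAdjoinAdjoin

/-! ### Valuation rings containing the constants. -/

section Valuation

variable {F K : Type*} [Field F] [Field K] [Algebra F K]

/-- A valuation ring contains every element integral over a ring that it contains. -/
lemma ValuationSubring.mem_of_isIntegralElem (V : ValuationSubring K) {R : Type*} [CommRing R]
    (f : R →+* K) (hf : ∀ r, f r ∈ V) {x : K} (hx : f.IsIntegralElem x) : x ∈ V := by
  obtain ⟨p, hm, hp⟩ := hx
  let φ : R →+* V := f.codRestrict V.toSubring hf
  have h : IsIntegral V x := by
    refine ⟨p.map φ, hm.map φ, ?_⟩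
    rw [eval₂_map]
    exact hp
  obtain ⟨y, hy⟩ := IsIntegrallyClosed.isIntegral_iff.1 h
  exact hy ▸ y.2

lemma ValuationSubring.valuation_algebraMap {V : ValuationSubring K}
    (hV : ∀ c : F, algebraMap F K c ∈ V) {c : F} (hc : c ≠ 0) :
    V.valuation (algebraMap F K c) = 1 := by
  refine le_antisymm ((V.valuation_le_one_iff _).2 (hV c)) ?_
  have h := (V.valuation_le_one_iff _).2 (hV c⁻¹)
  have hne : V.valuation (algebraMap F K c) ≠ 0 := by simpa using hc
  rwa [map_inv₀, map_inv₀, inv_le_one₀ (zero_lt_iff.2 hne)] at h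

lemma aeval_eq_mul_divX_add (u : K) (p : F[X]) :
    aeval u p = u * aeval u p.divX + algebraMap F K (p.coeff 0) := by
  conv_lhs => rw [← X_mul_divX_add p]
  rw [map_add, map_mul, aeval_X, aeval_C]

lemma ValuationSubring.aeval_mem {V : ValuationSubring K} (hV : ∀ c : F, algebraMap F K c ∈ V)
    {u : K} (hu : u ∈ V) (p : F[X]) : aeval u p ∈ V := by
  rw [aeval_eq_sum_range]
  refine V.toSubring.sum_mem fun i _ => ?_
  rw [Algebra.smul_def]
  exact V.mul_mem _ _ (hV _) (V.toSubring.pow_mem hu i)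

lemma ValuationSubring.valuation_aeval_eq_one {V : ValuationSubring K}
    (hV : ∀ c : F, algebraMap F K c ∈ V) {u : K} (hu : V.valuation u < 1) {p : F[X]}
    (hp : p.coeff 0 ≠ 0) : V.valuation (aeval u p) = 1 := by
  have h2 : V.valuation (u * aeval u p.divX) < 1 := by
    rw [map_mul]
    exact mul_lt_one_of_lt_of_le hu ((V.valuation_le_one_iff _).2
      (aeval_mem hV ((V.valuation_le_one_iff _).1 hu.le) _))
  rw [aeval_eq_mul_divX_add, Valuation.map_add_eq_of_lt_right, valuation_algebraMap hV hp]
  rwa [valuation_algebraMap hV hp]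

/-- If `u` has positive valuation and `y` is algebraic over `F(u)` then some `u ^ k * y` is
integral. -/
lemma ValuationSubring.exists_pow_mul_mem {V : ValuationSubring K}
    (hV : ∀ c : F, algebraMap F K c ∈ V) {u : K} (hu : V.valuation u < 1) {y : K}
    (hy : IsAlgebraic (Algebra.adjoin F {u}) y) : ∃ k : ℕ, u ^ k * y ∈ V := by
  have huV := (V.valuation_le_one_iff _).1 hu.le
  have hmem : ∀ r : Algebra.adjoin F {u}, ∃ p : F[X], aeval u p = (r : K) := fun r =>
    (Algebra.adjoin_singleton_eq_range_aeval F u).le r.2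
  obtain ⟨r, hr0, hr⟩ := hy.exists_integral_multiple
  obtain ⟨p, hp⟩ := hmem r
  have hp0 : p ≠ 0 := by
    rintro rfl
    exact hr0 (Subtype.ext (by rw [← hp, map_zero]; rfl))
  have h1 : (r : K) * y ∈ V := by
    refine V.mem_of_isIntegralElem (algebraMap (Algebra.adjoin F {u}) K) (fun s => ?_) hr
    obtain ⟨q, hq⟩ := hmem s
    change (s : K) ∈ V
    rw [← hq]
    exact aeval_mem hV huV q
  obtain ⟨g, hg, hXg⟩ := exists_eq_pow_rootMultiplicity_mul_and_not_dvd p hp0 0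
  rw [C_0, sub_zero] at hg hXg
  refine ⟨p.rootMultiplicity 0, ?_⟩
  have h2 : V.valuation (aeval u g) = 1 :=
    valuation_aeval_eq_one hV hu fun h => hXg (X_dvd_iff.2 h)
  rw [← V.valuation_le_one_iff] at h1 ⊢
  rwa [← hp, hg, map_mul (aeval u), map_pow, aeval_X, map_mul, map_mul, h2, mul_one, ← map_mul] at h1

end Valuation

/-! ### Places: Archimedean property and weak approximation. -/

namespace Place

variable {F K : Type*} [Field F] [Field K] [Algebra F K]

lemma val_le_one_iff (P : Place F K) {x : K} : P.val x ≤ 1 ↔ x ∈ P.ring :=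
  P.ring.valuation_le_one_iff x

lemma val_algebraMap_le_one (P : Place F K) (c : F) : P.val (algebraMap F K c) ≤ 1 :=
  P.val_le_one_iff.2 (P.algebraMap_mem c)

lemma val_algebraMap (P : Place F K) {c : F} (hc : c ≠ 0) : P.val (algebraMap F K c) = 1 :=
  ValuationSubring.valuation_algebraMap P.algebraMap_mem hc

lemma val_sum_le (P : Place F K) {ι : Type*} {s : Finset ι} {f : ι → K} {γ : P.ring.ValueGroup}
    (h : ∀ i ∈ s, P.val (f i) ≤ γ) : P.val (∑ i ∈ s, f i) ≤ γ :=
  Valuation.map_sum_le P.val h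

lemma val_le_one_of_isIntegralElem (P : Place F K) {R : Type*} [CommRing R] (f : R →+* K)
    (hf : ∀ r, P.val (f r) ≤ 1) {x : K} (hx : f.IsIntegralElem x) : P.val x ≤ 1 :=
  P.val_le_one_iff.2 (P.ring.mem_of_isIntegralElem f (fun r => P.val_le_one_iff.1 (hf r)) hx)

lemma val_le_one_of_isIntegral (P : Place F K) {S : Subalgebra F K}
    (hS : ∀ s ∈ S, P.val s ≤ 1) {x : K} (hx : IsIntegral S x) : P.val x ≤ 1 :=
  P.val_le_one_of_isIntegralElem (algebraMap S K) (fun r => hS _ r.2) hx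

lemma val_eq_one_of_isAlgebraic (P : Place F K) {x : K} (hx : IsAlgebraic F x) (h0 : x ≠ 0) :
    P.val x = 1 := by
  have key : ∀ y : K, IsAlgebraic F y → P.val y ≤ 1 := fun y hy =>
    P.val_le_one_of_isIntegralElem (algebraMap F K) P.val_algebraMap_le_one hy.isIntegral
  refine le_antisymm (key x hx) ?_
  have h := key x⁻¹ hx.inv
  rwa [map_inv₀, inv_le_one₀ (zero_lt_iff.2 (by simpa using h0))] at h

lemma transcendental_of_val_lt_one (P : Place F K) {x : K} (h0 : x ≠ 0) (hx : P.val x < 1) :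
    Transcendental F x := fun h => hx.ne (P.val_eq_one_of_isAlgebraic h h0)

lemma val_aeval_le_one (P : Place F K) {u : K} (hu : P.val u ≤ 1) (p : F[X]) :
    P.val (aeval u p) ≤ 1 :=
  P.val_le_one_iff.2 (ValuationSubring.aeval_mem P.algebraMap_mem (P.val_le_one_iff.1 hu) p)

lemma val_aeval_eq_one (P : Place F K) {u : K} (hu : P.val u < 1) {p : F[X]}
    (hp : p.coeff 0 ≠ 0) : P.val (aeval u p) = 1 :=
  ValuationSubring.valuation_aeval_eq_one P.algebraMap_mem hu hp

/-- This is Krull's intersection theorem in the discrete valuation ring, and it supplies the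
Archimedean property of the value group. -/
lemma eventually_pow_lt (P : Place F K) {x z : K} (hx : P.val x < 1) (hz : z ≠ 0) :
    ∀ᶠ N in Filter.atTop, P.val (x ^ N) < P.val z := by
  have := P.isDVR
  by_cases hzO : P.val z ≤ 1
  swap
  · filter_upwards with N
    rw [map_pow]
    exact (pow_le_one' hx.le N).trans_lt (not_le.1 hzO)
  let x' : P.ring := ⟨x, P.val_le_one_iff.1 hx.le⟩
  let z' : P.ring := ⟨z, P.val_le_one_iff.1 hzO⟩
  have hx' : x' ∈ IsLocalRing.maximalIdeal P.ring := by
    rw [ValuationSubring.valuation_lt_one_iff]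
    exact hx
  have hbot : z' ∉ (⊥ : Ideal P.ring) := by
    rw [Ideal.mem_bot]
    exact fun h => hz (congrArg Subtype.val h)
  rw [← Ideal.iInf_pow_eq_bot_of_isLocalRing (IsLocalRing.maximalIdeal P.ring)
    Ideal.IsPrime.ne_top', Ideal.mem_iInf, not_forall] at hbot
  obtain ⟨i, hi⟩ := hbot
  filter_upwards [Filter.eventually_ge_atTop i] with N hN
  by_contra! hlt
  apply hi
  have hx0 : x ^ N ≠ 0 := fun h => hz (by
    rw [h, map_zero] at hlt
    exact (map_eq_zero P.val).1 (le_antisymm hlt zero_le))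
  have hw : z / x ^ N ∈ P.ring := by
    rw [← P.val_le_one_iff, map_div₀]
    exact (div_le_one₀ (zero_lt_iff.2 (by simpa using hx0))).2 hlt
  have : z' = x' ^ N * ⟨_, hw⟩ := Subtype.ext (by simp [z', x', mul_div_cancel₀ _ hx0])
  rw [this]
  exact Ideal.mul_mem_right _ _ (Ideal.pow_le_pow_right hN (Ideal.pow_mem_pow hx' N))

lemma exists_val_lt_one (P : Place F K) : ∃ x : K, x ≠ 0 ∧ P.val x < 1 := by
  have := P.isDVR
  obtain ⟨ϖ, hϖ⟩ := IsDiscreteValuationRing.exists_irreducible P.ring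
  refine ⟨ϖ, fun h => hϖ.ne_zero (Subtype.ext h), ?_⟩
  rw [← ValuationSubring.valuation_lt_one_iff]
  exact hϖ.not_isUnit

/-- Discrete valuation rings are maximal subrings. If `y` were integral at `Q` but not at `P`, then
`y⁻¹ ^ N / m`, with `m` vanishing at `Q`, would be integral at `P` for large `N`, hence at `Q`,
which is impossible. -/
lemma eq_of_le {P Q : Place F K} (h : ∀ x, P.val x ≤ 1 → Q.val x ≤ 1) : P = Q := by
  refine Place.ext (le_antisymm (fun x hx => Q.val_le_one_iff.1 (h x (P.val_le_one_iff.2 hx))) ?_)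
  intro y hy
  rw [← Q.val_le_one_iff] at hy
  rw [← P.val_le_one_iff]
  by_contra! hlt
  have hy0 : y ≠ 0 := by rintro rfl; simp at hlt
  obtain ⟨m, hm0, hm⟩ := Q.exists_val_lt_one
  obtain ⟨N, hN⟩ := (P.eventually_pow_lt (x := y⁻¹) (z := m)
    (by rw [map_inv₀]; exact inv_lt_one_of_one_lt₀ hlt) hm0).exists
  have h1 := h (y⁻¹ ^ N / m) (by
    rw [map_div₀]; exact (div_le_one₀ (zero_lt_iff.2 (by simpa using hm0))).2 hN.le)
  rw [map_div₀, div_le_one₀ (zero_lt_iff.2 (by simpa using hm0))] at h1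
  have h2 := h1.trans_lt hm
  rw [inv_pow, map_inv₀, inv_lt_one₀ (zero_lt_iff.2 (by simp [hy0])), map_pow] at h2
  exact absurd (pow_le_one' hy N) (not_le.2 h2)

/-- Weak approximation, in the form of Artin and Whaples. -/
lemma exists_one_lt_val_forall_val_lt_one (Q : Place F K) (T : Finset (Place F K)) (hT : Q ∉ T) :
    ∃ x : K, 1 < Q.val x ∧ ∀ P ∈ T, P.val x < 1 := by
  classical
  have two : ∀ P : Place F K, P ≠ Q → ∃ x : K, 1 < Q.val x ∧ P.val x < 1 := by
    intro P hPQ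
    obtain ⟨a, ha, ha'⟩ : ∃ a, P.val a ≤ 1 ∧ 1 < Q.val a := by
      by_contra! h; exact hPQ (eq_of_le h)
    obtain ⟨b, hb, hb'⟩ : ∃ b, Q.val b ≤ 1 ∧ 1 < P.val b := by
      by_contra! h; exact hPQ (eq_of_le h).symm
    have hb0 : b ≠ 0 := by rintro rfl; simp at hb'
    refine ⟨a / b, ?_, ?_⟩
    · rw [map_div₀, one_lt_div₀ (zero_lt_iff.2 (by simpa using hb0))]
      exact hb.trans_lt ha'
    · rw [map_div₀, div_lt_one₀ (zero_lt_iff.2 (by simpa using hb0))]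
      exact ha.trans_lt hb'
  induction T using Finset.induction_on with
  | empty =>
    obtain ⟨x, hx0, hx⟩ := Q.exists_val_lt_one
    exact ⟨x⁻¹, by rw [map_inv₀]; exact (one_lt_inv₀ (zero_lt_iff.2 (by simpa using hx0))).2 hx,
      by simp⟩
  | insert R T hR ih =>
    rw [Finset.mem_insert, not_or] at hT
    obtain ⟨x, hxQ, hxT⟩ := ih hT.2
    obtain ⟨z, hzQ, hzR⟩ := two R (Ne.symm hT.1)
    have hx0 : x ≠ 0 := by rintro rfl; simp at hxQ
    have hz0 : z ≠ 0 := by rintro rfl; simp at hzQ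
    have small : ∀ᶠ N in Filter.atTop, ∀ P ∈ T, P.val (x ^ N * z) < 1 := by
      rw [Filter.eventually_all_finset]
      intro P hP
      filter_upwards [P.eventually_pow_lt (hxT P hP) (inv_ne_zero hz0)] with N hN
      rwa [map_mul, ← lt_inv_mul_iff₀' (zero_lt_iff.2 (by simpa using hz0)), mul_one, ← map_inv₀]
    obtain ⟨N, hN, hN1⟩ := (small.and (Filter.eventually_ge_atTop 1)).exists
    rcases le_or_gt (R.val x) 1 with hxR | hxR
    · refine ⟨x ^ N * z, ?_, fun P hP => ?_⟩
      · rw [map_mul, map_pow]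
        exact hzQ.trans_le (le_mul_of_one_le_left zero_le (one_le_pow₀ hxQ.le))
      · rcases Finset.mem_insert.1 hP with rfl | hP
        · rw [map_mul, map_pow]
          exact (mul_le_of_le_one_left zero_le (pow_le_one' hxR N)).trans_lt hzR
        · exact hN P hP
    -- The factor `x ^ N / (1 + x ^ N)` is a unit where `x` has a pole and has the size of `x ^ N`
    -- where `x` vanishes, so the pole of `x` at `R` does no harm.
    · have big : ∀ P : Place F K, 1 < P.val x → P.val (x ^ N / (1 + x ^ N) * z) = P.val z := by
        intro P hP
        have h1 : 1 < P.val (x ^ N) := by rw [map_pow]; exact one_lt_pow₀ hP (by omega)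
        have h2 : P.val (1 + x ^ N) = P.val (x ^ N) :=
          Valuation.map_add_eq_of_lt_right _ (by rwa [map_one])
        rw [map_mul, map_div₀, h2, div_self (by simp [hx0]), one_mul]
      refine ⟨x ^ N / (1 + x ^ N) * z, by rwa [big Q hxQ], fun P hP => ?_⟩
      rcases Finset.mem_insert.1 hP with rfl | hP
      · rwa [big P hxR]
      · have h1 : P.val (x ^ N) < 1 := by
          rw [map_pow]; exact pow_lt_one₀ zero_le (hxT P hP) (by omega)
        have h2 : P.val (1 + x ^ N) = 1 := by
          rw [Valuation.map_add_eq_of_lt_left _ (by rwa [map_one]), map_one]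
        rw [map_mul, map_div₀, h2, div_one, ← map_mul]
        exact hN P hP

end Place

/-! ### Rank over `F(u)` controlled by reduction modulo `u`. -/

section ModulesModU

variable {F K : Type*} [Field F] [Field K] [Algebra F K] {u : K}

lemma exists_eq_X_mul {p : F[X]} (h : p.coeff 0 = 0) : ∃ q, p = X * q :=
  X_dvd_iff.2 h

/-- A finite family is linearly independent over `F(u)` as soon as the coefficients of every
relation over `F[u]` vanish at `u = 0`. -/
lemma linearIndependent_of_coeff_zero (hu : Transcendental F u) {ι : Type*} [Fintype ι]
    (b : ι → K)
    (h : ∀ p : ι → F[X], ∑ i, aeval u (p i) * b i = 0 → ∀ i, (p i).coeff 0 = 0) :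
    LinearIndependent F⟮u⟯ b := by
  have hu0 : u ≠ 0 := by
    rintro rfl
    exact hu isAlgebraic_zero
  -- Infinite descent: once all constant terms vanish, the relation can be divided by `u`, so the
  -- coefficients are divisible by every power of `X`.
  have hdvd : ∀ (k : ℕ) (p : ι → F[X]), ∑ i, aeval u (p i) * b i = 0 → ∀ i, X ^ k ∣ p i := by
    intro k
    induction k with
    | zero => intro p _ i; simp
    | succ k ih =>
      intro p hp
      choose q hq using fun i => exists_eq_X_mul (h p hp i)
      have hq0 : ∑ i, aeval u (q i) * b i = 0 := by
        have : u * ∑ i, aeval u (q i) * b i = 0 := by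
          rw [← hp, Finset.mul_sum]
          refine Finset.sum_congr rfl fun i _ => ?_
          rw [hq i, map_mul, aeval_X, mul_assoc]
        exact (mul_eq_zero.1 this).resolve_left hu0
      intro i
      rw [hq i, pow_succ']
      exact mul_dvd_mul_left X (ih q hq0 i)
  rw [← LinearIndependent.iff_fractionRing (Algebra.adjoin F {u}) F⟮u⟯, Fintype.linearIndependent_iff]
  intro g hg i
  have hmem : ∀ i, ∃ p : F[X], aeval u p = (g i : K) := fun i =>
    (Algebra.adjoin_singleton_eq_range_aeval F u).le (g i).2
  choose p hp using hmem
  have hp0 : p i = 0 := by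
    by_contra hne
    have hd := hdvd ((p i).natDegree + 1) p (by simpa [hp, Algebra.smul_def] using hg) i
    have := natDegree_le_of_dvd hd hne
    simp at this
  exact Subtype.ext (by rw [← hp i, hp0, map_zero]; rfl)

/-- The family `b` of elements of `O` is linearly independent over `F` modulo `u O`. -/
def LinIndepMod (O : Subalgebra F K) (u : K) {ι : Type*} [Fintype ι] (b : ι → K) : Prop :=
  ∀ c : ι → F, (∃ z ∈ O, ∑ i, algebraMap F K (c i) * b i = u * z) → ∀ i, c i = 0

variable {O : Subalgebra F K}

lemma aeval_mem_of_mem (hu : u ∈ O) (p : F[X]) : aeval u p ∈ O := by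
  rw [aeval_eq_sum_range]
  exact O.sum_mem fun i _ => O.smul_mem (O.pow_mem hu i) _

lemma LinIndepMod.coeff_zero {ι : Type*} [Fintype ι] {b : ι → K} (hb : LinIndepMod O u b)
    (hu : u ∈ O) (hbO : ∀ i, b i ∈ O) {p : ι → F[X]} {z : K} (hz : z ∈ O)
    (h : ∑ i, aeval u (p i) * b i = u * z) (i : ι) : (p i).coeff 0 = 0 := by
  refine hb (fun i => (p i).coeff 0) ⟨z - ∑ i, aeval u (p i).divX * b i, ?_, ?_⟩ i
  · exact O.sub_mem hz (O.sum_mem fun i _ => O.mul_mem (aeval_mem_of_mem hu _) (hbO i))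
  · rw [mul_sub, ← h, Finset.mul_sum, ← Finset.sum_sub_distrib]
    refine Finset.sum_congr rfl fun i _ => ?_
    rw [aeval_eq_mul_divX_add u (p i)]
    ring

lemma LinIndepMod.linearIndependent {ι : Type*} [Fintype ι] {b : ι → K} (hb : LinIndepMod O u b)
    (htr : Transcendental F u) (hu : u ∈ O) (hbO : ∀ i, b i ∈ O) : LinearIndependent F⟮u⟯ b :=
  linearIndependent_of_coeff_zero htr b fun _ hp i =>
    hb.coeff_zero hu hbO O.zero_mem (by rw [hp, mul_zero]) i

/-- Such a family has full rank, and `x` then lies in the localization at `u = 0` of the `F[u]`-span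
of `b`. Otherwise every relation between `x` and `b` would have constant terms 0, making `x`
together with `b` independent and too large. -/
lemma LinIndepMod.exists_mul_eq_sum {ι : Type*} [Fintype ι] {b : ι → K} (hb : LinIndepMod O u b)
    [FiniteDimensional F⟮u⟯ K] (hcard : Module.finrank F⟮u⟯ K ≤ Fintype.card ι)
    (htr : Transcendental F u) (hu : u ∈ O) (hbO : ∀ i, b i ∈ O) {x : K} (hx : x ∈ O) :
    ∃ g : F[X], g.coeff 0 ≠ 0 ∧ ∃ p : ι → F[X], aeval u g * x = ∑ i, aeval u (p i) * b i := by
  by_contra! hcon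
  have hli : LinearIndependent F⟮u⟯ (fun o : Option ι => o.elim x b) := by
    refine linearIndependent_of_coeff_zero htr _ fun p hp => ?_
    rw [Fintype.sum_option] at hp
    have hp' : aeval u (p none) * x = ∑ i, aeval u (-p (some i)) * b i := by
      simp only [map_neg, neg_mul, Finset.sum_neg_distrib]
      exact eq_neg_of_add_eq_zero_left hp
    have h0 : (p none).coeff 0 = 0 := by
      by_contra hne
      exact hcon _ hne _ hp'
    obtain ⟨q, hq⟩ := exists_eq_X_mul h0
    rintro (_ | i)
    · exact h0
    · have := hb.coeff_zero hu hbO (p := fun i => -p (some i)) (z := aeval u q * x)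
        (O.mul_mem (aeval_mem_of_mem hu q) hx)
        (by rw [← hp', hq, map_mul, aeval_X, mul_assoc]) i
      simpa using this
  have := hli.fintype_card_le_finrank
  rw [Fintype.card_option] at this
  omega

lemma LinIndepMod.of_linearIndependent {V : Type*} [AddCommGroup V] [Module F V] (φ : O →ₗ[F] V)
    (hker : ∀ y : O, (∃ z ∈ O, (y : K) = u * z) → φ y = 0) {ι : Type*} [Fintype ι] {q : ι → V}
    (hq : LinearIndependent F q) (b : ι → O) (hb : ∀ i, φ (b i) = q i) : LinIndepMod O u (fun i => (b i : K)) := by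
  intro c hc
  refine Fintype.linearIndependent_iff.1 hq c ?_
  have : ∑ i, c i • q i = φ (∑ i, c i • b i) := by simp [hb]
  rw [this]
  exact hker _ (by simpa [Algebra.smul_def] using hc)

/-- Lifts of independent classes in `O / u O` stay independent over `F(u)`, so `O / u O` has
dimension at most `[K : F(u)]`; `b` lifts a basis. -/
lemma exists_linIndepMod (htr : Transcendental F u) [FiniteDimensional F⟮u⟯ K] (hu : u ∈ O) :
    ∃ m ≤ Module.finrank F⟮u⟯ K, ∃ b : Fin m → K, (∀ i, b i ∈ O) ∧ LinIndepMod O u b ∧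
      ∀ x ∈ O, ∃ c : Fin m → F, ∃ z ∈ O, x = ∑ i, algebraMap F K (c i) * b i + u * z := by
  let U : Submodule F O := LinearMap.range (LinearMap.mulLeft F (⟨u, hu⟩ : O))
  have hU : ∀ y : O, U.mkQ y = 0 ↔ ∃ z ∈ O, (y : K) = u * z := fun y => by
    rw [Submodule.mkQ_apply, Submodule.Quotient.mk_eq_zero]
    constructor
    · rintro ⟨a, rfl⟩
      exact ⟨a, a.2, rfl⟩
    · rintro ⟨z, hz, h⟩
      exact ⟨⟨z, hz⟩, Subtype.ext h.symm⟩
  have hrank : Module.rank F (O ⧸ U) ≤ Module.finrank F⟮u⟯ K := by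
    refine rank_le fun s hs => ?_
    choose b hb using fun i : s => U.mkQ_surjective (i : O ⧸ U)
    have hli := LinIndepMod.of_linearIndependent U.mkQ (fun y => (hU y).2) hs b hb
    simpa using (hli.linearIndependent htr hu fun i => (b i).2).fintype_card_le_finrank
  have : Module.Finite F (O ⧸ U) :=
    Module.rank_lt_aleph0_iff.1 (hrank.trans_lt Cardinal.natCast_lt_aleph0)
  let B := Module.finBasis F (O ⧸ U)
  choose b hb using fun i => U.mkQ_surjective (B i)
  refine ⟨_, Module.finrank_le_of_rank_le hrank, fun i => b i, fun i => (b i).2,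
    LinIndepMod.of_linearIndependent U.mkQ (fun y => (hU y).2) B.linearIndependent b hb, fun x hx => ?_⟩
  let c := B.repr (U.mkQ ⟨x, hx⟩)
  have hmem : U.mkQ (⟨x, hx⟩ - ∑ i, c i • b i) = 0 := by
    rw [map_sub, sub_eq_zero, map_sum]
    conv_lhs => rw [← B.sum_repr (U.mkQ ⟨x, hx⟩)]
    exact Finset.sum_congr rfl fun i _ => by rw [map_smul, hb]
  obtain ⟨z, hz, h⟩ := (hU _).1 hmem
  refine ⟨c, z, hz, ?_⟩
  rw [← h]
  simp [Algebra.smul_def]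

/-- If `O / u O` is spanned by `m` elements then `O / u ^ k O` is spanned by `k * m` elements. -/
lemma exists_submodule_sup_pow {m : ℕ} {b : Fin m → K} (hu : u ∈ O) (hbO : ∀ i, b i ∈ O)
    (hspan : ∀ x ∈ O, ∃ c : Fin m → F, ∃ z ∈ O, x = ∑ i, algebraMap F K (c i) * b i + u * z)
    (k : ℕ) :
    ∃ T : Submodule F K, FiniteDimensional F T ∧ Module.finrank F T ≤ k * m ∧
      (∀ t ∈ T, t ∈ O) ∧ ∀ x ∈ O, ∃ t ∈ T, ∃ z ∈ O, x = t + u ^ k * z := by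
  induction k with
  | zero => exact ⟨⊥, inferInstance, by simp, fun t ht => by
      rw [(Submodule.mem_bot F).1 ht]; exact O.zero_mem, fun x hx => ⟨0, by simp, x, hx, by simp⟩⟩
  | succ k ih =>
    obtain ⟨T, hfin, hrank, hTO, hT⟩ := ih
    let S : Submodule F K := Submodule.span F (Set.range b)
    have hS : FiniteDimensional F S := FiniteDimensional.span_of_finite F (Set.finite_range b)
    refine ⟨S ⊔ T.map (LinearMap.mulLeft F u), inferInstance, ?_, ?_, ?_⟩
    · refine (Submodule.finrank_add_le_finrank_add_finrank _ _).trans ?_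
      have h1 : Module.finrank F S ≤ m :=
        (finrank_range_le_card b).trans_eq (Fintype.card_fin m)
      have h2 := Submodule.finrank_map_le (LinearMap.mulLeft F u) T
      rw [add_mul, one_mul]
      omega
    · have hle : S ⊔ T.map (LinearMap.mulLeft F u) ≤ Subalgebra.toSubmodule O := by
        refine sup_le (Submodule.span_le.2 ?_) ?_
        · rintro _ ⟨i, rfl⟩
          exact hbO i
        · rintro _ ⟨t, ht, rfl⟩
          exact O.mul_mem hu (hTO t ht)
      exact fun t ht => hle ht
    · intro x hx
      obtain ⟨c, z, hz, rfl⟩ := hspan x hx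
      obtain ⟨t, ht, y, hy, rfl⟩ := hT z hz
      refine ⟨∑ i, algebraMap F K (c i) * b i + u * t, ?_, y, hy, by ring⟩
      refine Submodule.add_mem_sup (Submodule.sum_mem _ fun i _ => ?_)
        (Submodule.mem_map.2 ⟨t, ht, rfl⟩)
      rw [← Algebra.smul_def]
      exact Submodule.smul_mem _ _ (Submodule.subset_span ⟨i, rfl⟩)

/-- If `O / u O` attains the full dimension, no element of `O` can have a pole at a zero of `u`.
Some `G(u)` with `G(0) ≠ 0` makes `G(u) * x` preserve the finitely generated `F[u]`-span of `b`,
hence integral over `F[u]`, and `G(u)` is a unit at `Q`. -/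
lemma LinIndepMod.val_le_one {ι : Type*} [Fintype ι] {b : ι → K} (hb : LinIndepMod O u b)
    [FiniteDimensional F⟮u⟯ K] (hcard : Module.finrank F⟮u⟯ K ≤ Fintype.card ι)
    (htr : Transcendental F u) (hu : u ∈ O) (hbO : ∀ i, b i ∈ O)
    (Q : Place F K) (hQ : Q.val u < 1) {x : K} (hx : x ∈ O) : Q.val x ≤ 1 := by
  choose g hg p hp using fun i : ι =>
    hb.exists_mul_eq_sum hcard htr hu hbO (O.mul_mem hx (hbO i))
  classical
  let G : F[X] := ∏ i, g i
  have hG : G.coeff 0 ≠ 0 := by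
    rw [coeff_zero_eq_eval_zero, eval_prod, Finset.prod_ne_zero_iff]
    intro i _
    rw [← coeff_zero_eq_eval_zero]
    exact hg i
  let N : Submodule (Algebra.adjoin F {u}) K := Submodule.span _ (Set.range b)
  have hmemN : ∀ (q : F[X]) (y : K), y ∈ N → aeval u q * y ∈ N := fun q y hy =>
    N.smul_mem (⟨aeval u q, aeval_mem_of_mem (Algebra.self_mem_adjoin_singleton F u) q⟩ :
      Algebra.adjoin F {u}) hy
  have hint : IsIntegral (Algebra.adjoin F {u}) (aeval u G * x) := by
    refine isIntegral_of_smul_mem_submodule N ?_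
      (Submodule.fg_span (Set.finite_range b)) _ ?_
    · have hpos : 0 < Fintype.card ι := Module.finrank_pos.trans_le hcard
      obtain ⟨i⟩ := Fintype.card_pos_iff.1 hpos
      intro hbot
      have h0 : b i ∈ N := Submodule.subset_span ⟨i, rfl⟩
      rw [hbot, Submodule.mem_bot] at h0
      exact (hb.linearIndependent htr hu hbO).ne_zero i h0
    · intro y hy
      induction hy using Submodule.span_induction with
      | mem y hy =>
        obtain ⟨i, rfl⟩ := hy
        have : (aeval u G * x) • b i =
            aeval u (∏ j ∈ Finset.univ.erase i, g j) * ∑ j, aeval u (p i j) * b j := by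
          rw [← hp i, ← mul_assoc, ← map_mul, Finset.prod_erase_mul _ _ (Finset.mem_univ i),
            smul_eq_mul, mul_assoc]
        rw [this]
        exact hmemN _ _ (N.sum_mem fun j _ => hmemN _ _ (Submodule.subset_span ⟨j, rfl⟩))
      | zero => rw [smul_zero]; exact N.zero_mem
      | add y z _ _ hy hz => rw [smul_add]; exact N.add_mem hy hz
      | smul a y _ hy => rw [smul_comm]; exact N.smul_mem a hy
  have h1 : Q.val (aeval u G * x) ≤ 1 := by
    refine Q.val_le_one_of_isIntegral (S := Algebra.adjoin F {u}) (fun s hs => ?_) hint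
    rw [Algebra.adjoin_singleton_eq_range_aeval] at hs
    obtain ⟨q, rfl⟩ := hs
    exact Q.val_aeval_le_one hQ.le q
  rwa [map_mul, Q.val_aeval_eq_one hQ hG, one_mul] at h1

end ModulesModU

/-! ### Finiteness of the set of zeros. -/

namespace Place

variable {F K : Type*} [Field F] [Field K] [Algebra F K] {u : K}

/-- Choose for each `P` an element with a pole at `P` and vanishing at the rest of `T`. In a
relation, a coefficient at `P` with nonzero constant term would leave one term with a pole at `P`
against integral ones. -/
lemma card_le_finrank (htr : Transcendental F u) [FiniteDimensional F⟮u⟯ K]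
    (T : Finset (Place F K)) (hT : ∀ P ∈ T, P.val u < 1) :
    T.card ≤ Module.finrank F⟮u⟯ K := by
  classical
  choose x hx1 hx using fun P : T =>
    exists_one_lt_val_forall_val_lt_one (P : Place F K) (T.erase P) (Finset.notMem_erase _ _)
  have hli : LinearIndependent F⟮u⟯ x := by
    refine linearIndependent_of_coeff_zero htr x fun p hp => ?_
    by_contra! hne
    obtain ⟨P, hP⟩ := hne
    have hu := hT P P.2
    have h1 : P.1.val (aeval u (p P) * x P) = P.1.val (x P) := by
      rw [map_mul, val_aeval_eq_one _ hu hP, one_mul]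
    have h2 : P.1.val (∑ R ∈ Finset.univ.erase P, aeval u (p R) * x R) ≤ 1 := by
      refine P.1.val_sum_le fun R hR => ?_
      rw [map_mul]
      refine mul_le_one' (val_aeval_le_one _ hu.le _) (hx R P ?_).le
      refine Finset.mem_erase.2 ⟨fun h => ?_, P.2⟩
      exact Finset.ne_of_mem_erase hR (Subtype.ext h.symm)
    rw [← Finset.add_sum_erase _ _ (Finset.mem_univ P), add_eq_zero_iff_eq_neg] at hp
    have h3 := hx1 P
    rw [← h1, hp, Valuation.map_neg] at h3
    exact absurd h2 (not_le.2 h3)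
  simpa using hli.fintype_card_le_finrank

lemma finite_setOf_val_lt_one (htr : Transcendental F u) [FiniteDimensional F⟮u⟯ K] :
    {P : Place F K | P.val u < 1}.Finite := by
  by_contra hinf
  obtain ⟨T, hT, hcard⟩ := Set.Infinite.exists_subset_card_eq hinf (Module.finrank F⟮u⟯ K + 1)
  have := card_le_finrank htr T fun P hP => hT hP
  omega

end Place

/-! ### Every transcendental element has a zero. -/

section PlaceExistence

variable {F K : Type*} [Field F] [Field K] [Algebra F K] {u : K}

lemma exists_valuationSubring_valuation_lt_one (htr : Transcendental F u) :
    ∃ V : ValuationSubring K, (∀ c : F, algebraMap F K c ∈ V) ∧ V.valuation u < 1 := by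
  let A : Subring K := (Algebra.adjoin F {u}).toSubring
  have huA : u ∈ A := Algebra.self_mem_adjoin_singleton F u
  have hI : Ideal.span {(⟨u, huA⟩ : A)} ≠ ⊤ := by
    rw [Ne, Ideal.eq_top_iff_one, Ideal.mem_span_singleton']
    rintro ⟨⟨a, ha⟩, h⟩
    obtain ⟨p, hp⟩ := (Algebra.adjoin_singleton_eq_range_aeval F u).le ha
    have h1 : aeval u (p * X - 1) = 0 := by
      rw [map_sub, map_mul, aeval_X, map_one, sub_eq_zero]
      change aeval u p = a at hp
      rw [hp]
      exact congrArg Subtype.val h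
    have h2 := (transcendental_iff.1 htr) _ h1
    simpa using congrArg (eval 0) h2
  obtain ⟨V, hAV, hV⟩ := Ideal.image_subset_nonunits_valuationSubring _ hI
  refine ⟨V, fun c => hAV (Subalgebra.algebraMap_mem (Algebra.adjoin F {u}) c), ?_⟩
  rw [← ValuationSubring.mem_nonunits_iff]
  exact hV ⟨⟨u, huA⟩, Ideal.subset_span rfl, rfl⟩

lemma isAlgebraic_adjoin_of_finiteDimensional [FiniteDimensional F⟮u⟯ K] (y : K) :
    IsAlgebraic (Algebra.adjoin F {u}) y :=
  (IsFractionRing.isAlgebraic_iff (Algebra.adjoin F {u}) F⟮u⟯ K).2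
    (Algebra.IsAlgebraic.isAlgebraic y)

/-- A nonzero ideal `I` contains some `u ^ k`, because the inverse of an element of `I` is algebraic
over `F[u]`. As `V / u ^ k V` is finite-dimensional over `F`, `I` is generated by `u ^ k` and
finitely many elements. So `V` is Noetherian, and it is not a field. -/
lemma ValuationSubring.isDiscreteValuationRing (htr : Transcendental F u)
    [FiniteDimensional F⟮u⟯ K] (V : ValuationSubring K) (hV : ∀ c : F, algebraMap F K c ∈ V)
    (hu : V.valuation u < 1) : IsDiscreteValuationRing V := by
  have hu0 : u ≠ 0 := by
    rintro rfl
    exact htr isAlgebraic_zero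
  have huV : u ∈ V := (V.valuation_le_one_iff _).1 hu.le
  let O : Subalgebra F K := { V.toSubring with algebraMap_mem' := hV }
  obtain ⟨m, -, b, hbO, -, hspan⟩ := exists_linIndepMod (O := O) htr huV
  have hnoeth : IsNoetherianRing V := by
    refine ⟨fun (I : Ideal V) => ?_⟩
    by_cases hI : I = ⊥
    · rw [hI]; exact Submodule.fg_bot
    obtain ⟨x, hxI, hx0⟩ := Submodule.exists_mem_ne_zero_of_ne_bot hI
    have hx0' : (x : K) ≠ 0 := fun h => hx0 (Subtype.ext h)
    obtain ⟨k, hk⟩ := ValuationSubring.exists_pow_mul_mem hV hu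
      (isAlgebraic_adjoin_of_finiteDimensional (F := F) (u := u) (x : K)⁻¹)
    let u' : V := ⟨u, huV⟩
    have hukI : u' ^ k ∈ I := by
      have : u' ^ k = ⟨_, hk⟩ * x := Subtype.ext (by
        simp [u', mul_assoc, inv_mul_cancel₀ hx0'])
      rw [this]
      exact I.mul_mem_left _ hxI
    obtain ⟨T, hTfin, -, hTO, hT⟩ := exists_submodule_sup_pow (O := O) huV hbO hspan k
    let toF : Ideal V → Submodule F K := fun M =>
      { carrier := {y | ∃ h : y ∈ V, (⟨y, h⟩ : V) ∈ M}
        zero_mem' := ⟨V.zero_mem, M.zero_mem⟩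
        add_mem' := fun ⟨h1, h1'⟩ ⟨h2, h2'⟩ => ⟨V.add_mem _ _ h1 h2, M.add_mem h1' h2'⟩
        smul_mem' := fun c y ⟨h, h'⟩ => by
          rw [Algebra.smul_def]
          exact ⟨V.mul_mem _ _ (hV c) h, M.mul_mem_left ⟨_, hV c⟩ h'⟩ }
    have hfin : FiniteDimensional F (T ⊓ toF I : Submodule F K) :=
      Submodule.finiteDimensional_of_le inf_le_left
    obtain ⟨S, hS⟩ := (Submodule.fg_iff_finiteDimensional _).2 hfin
    have hfinS : {y : V | (y : K) ∈ S}.Finite :=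
      S.finite_toSet.preimage Subtype.val_injective.injOn
    have hspanI : I = Ideal.span ({u' ^ k} ∪ {y : V | (y : K) ∈ S}) := by
      apply le_antisymm
      · intro x hx
        obtain ⟨t, ht, z, hz, hxtz⟩ := hT x x.2
        have htV : t ∈ V := hTO t ht
        have htI : (⟨t, htV⟩ : V) ∈ I := by
          have : (⟨t, htV⟩ : V) = x - u' ^ k * ⟨z, hz⟩ := Subtype.ext (by
            simp [u', hxtz])
          rw [this]
          exact I.sub_mem hx (I.mul_mem_right _ hukI)
        have hle : Submodule.span F (S : Set K) ≤
            toF (Ideal.span ({u' ^ k} ∪ {y : V | (y : K) ∈ S})) := by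
          refine Submodule.span_le.2 fun y hy => ?_
          have hyI : y ∈ T ⊓ toF I := hS ▸ Submodule.subset_span hy
          obtain ⟨hyV, -⟩ := hyI.2
          exact ⟨hyV, Ideal.subset_span (Or.inr hy)⟩
        rw [hS] at hle
        obtain ⟨h', htmem⟩ := hle ⟨ht, htV, htI⟩
        have : x = ⟨t, h'⟩ + u' ^ k * ⟨z, hz⟩ := Subtype.ext (by simp [u', hxtz])
        rw [this]
        exact Ideal.add_mem _ htmem (Ideal.mul_mem_right _ _ (Ideal.subset_span (Or.inl rfl)))
      · refine Ideal.span_le.2 ?_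
        rintro y (rfl | hy)
        · exact hukI
        · have hyI : (y : K) ∈ T ⊓ toF I := hS ▸ Submodule.subset_span hy
          exact hyI.2.2
    rw [hspanI]
    exact Submodule.fg_span ((Set.finite_singleton _).union hfinS)
  have hnf : ¬ IsField V := by
    intro hf
    obtain ⟨w, hw⟩ := hf.mul_inv_cancel (a := ⟨u, huV⟩) (fun h => hu0 (congrArg Subtype.val h))
    have h1 : V.valuation (u * w) = 1 := by
      have : u * (w : K) = 1 := congrArg Subtype.val hw
      rw [this, map_one]
    rw [map_mul] at h1
    exact (mul_lt_one_of_lt_of_le hu (V.valuation_le_one w)).ne h1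
  exact ((IsDiscreteValuationRing.TFAE V hnf).out 0 1 :
    IsDiscreteValuationRing V ↔ ValuationRing V).2 inferInstance

lemma Place.exists_val_lt_one_of_transcendental (htr : Transcendental F u)
    [FiniteDimensional F⟮u⟯ K] : ∃ P : Place F K, P.val u < 1 := by
  obtain ⟨V, hV, hu⟩ := exists_valuationSubring_valuation_lt_one htr
  exact ⟨⟨V, hV, V.isDiscreteValuationRing htr hV hu⟩, hu⟩

end PlaceExistence

/-! ### A Riemann-type count: a nonconstant function with its only pole at `Q`. -/

section RiemannCount

variable {F K : Type*} [Field F] [Field K] [Algebra F K] {u : K}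

lemma Submodule.finrank_le_finrank_add_finrank_inf {V : Type*} [AddCommGroup V] [Module F V]
    (W T U : Submodule F V) [FiniteDimensional F W] [FiniteDimensional F T] (h : W ≤ T ⊔ U) :
    Module.finrank F W ≤ Module.finrank F T + Module.finrank F (W ⊓ U : Submodule F V) := by
  let f : W →ₗ[F] V ⧸ U := U.mkQ.comp W.subtype
  rw [← LinearMap.finrank_range_add_finrank_ker f]
  have h1 : LinearMap.range f ≤ T.map U.mkQ := by
    rintro _ ⟨w, rfl⟩
    obtain ⟨t, ht, y, hy, hty⟩ := Submodule.mem_sup.1 (h w.2)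
    refine ⟨t, ht, ?_⟩
    simp only [f, LinearMap.comp_apply, Submodule.subtype_apply, ← hty, map_add]
    rw [(Submodule.Quotient.mk_eq_zero U).2 hy |> fun h : U.mkQ y = 0 => h, add_zero]
  have h2 : Module.finrank F (LinearMap.range f) ≤ Module.finrank F T :=
    (Submodule.finrank_mono h1).trans (Submodule.finrank_map_le _ _)
  have h3 : Module.finrank F (LinearMap.ker f) = Module.finrank F (W ⊓ U : Submodule F V) := by
    have : (LinearMap.ker f).map W.subtype = W ⊓ U := by
      rw [LinearMap.ker_comp, Submodule.ker_mkQ, Submodule.map_comap_subtype]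
    rw [← this, Submodule.finrank_map_subtype_eq]
  omega

lemma exists_linearIndependent_isIntegral (y : K) [FiniteDimensional F⟮y⟯ K] :
    ∃ e : Fin (Module.finrank F⟮y⟯ K) → K, LinearIndependent F⟮y⟯ e ∧
      ∀ i, IsIntegral (Algebra.adjoin F {y}) (e i) := by
  obtain ⟨s, b, hb⟩ := FiniteDimensional.exists_is_basis_integral (Algebra.adjoin F {y}) F⟮y⟯ K
  let E := Fintype.equivFinOfCardEq (Module.finrank_eq_card_basis b).symm
  exact ⟨fun i => b (E.symm i), b.linearIndependent.comp _ E.symm.injective, fun i => hb _⟩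

lemma adjoin_simple_inv (u : K) : F⟮u⁻¹⟯ = F⟮u⟯ := by
  apply le_antisymm
  · rw [adjoin_simple_le_iff]
    exact inv_mem (mem_adjoin_simple_self F u)
  · rw [adjoin_simple_le_iff]
    simpa using inv_mem (mem_adjoin_simple_self F u⁻¹)

lemma linearIndependent_pow_of_transcendental (htr : Transcendental F u) (N : ℕ) :
    LinearIndependent F fun i : Fin N => (AdjoinSimple.gen F u) ^ (i : ℕ) := by
  rw [Fintype.linearIndependent_iff]
  intro g hg i
  have h1 : aeval u (∑ i : Fin N, C (g i) * X ^ (i : ℕ)) = 0 := by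
    rw [map_sum, ← map_zero (algebraMap F⟮u⟯ K), ← hg, map_sum]
    refine Finset.sum_congr rfl fun i _ => ?_
    simp [Algebra.smul_def]
  have h2 := congrArg (fun p => coeff p (i : ℕ)) (transcendental_iff.1 htr _ h1)
  simpa [finsetSum_coeff, coeff_X_pow, Fin.val_inj] using h2

lemma linearIndependent_pow_mul (htr : Transcendental F u) (N c : ℕ) {n : ℕ} {e : Fin n → K}
    (he : LinearIndependent F⟮u⟯ e) :
    LinearIndependent F fun p : Fin N × Fin n => u ^ (p.1 : ℕ) * (u ^ c * e p.2) := by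
  have hu0 : u ≠ 0 := fun h => htr (h ▸ isAlgebraic_zero)
  have h1 : LinearIndependent F⟮u⟯ fun i => u ^ c * e i :=
    he.map' (LinearMap.mulLeft F⟮u⟯ (u ^ c))
      (LinearMap.ker_eq_bot.2 (mul_right_injective₀ (pow_ne_zero c hu0)))
  have h3 := linearIndependent_smul (linearIndependent_pow_of_transcendental htr N) h1
  have h2 : ∀ (i : ℕ) (y : K), AdjoinSimple.gen F u ^ i • y = u ^ i * y := fun i y => by
    rw [IntermediateField.smul_def, SubmonoidClass.coe_pow, AdjoinSimple.coe_gen, smul_eq_mul]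
  simpa only [h2] using h3

end RiemannCount

namespace Place

variable {F K : Type*} [Field F] [Field K] [Algebra F K]

lemma mem_integralOutside {Q : Place F K} {x : K} :
    x ∈ integralOutside Q ↔ ∀ P : Place F K, P ≠ Q → P.val x ≤ 1 := by
  simp only [integralOutside, Subring.mem_iInf, val_le_one_iff]
  rfl

/-- The elements integral at every place `≠ Q` at which `u` vanishes. -/
def integralAbove (Q : Place F K) (u : K) : Subalgebra F K where
  carrier := {x | ∀ P : Place F K, P ≠ Q → P.val u < 1 → P.val x ≤ 1}
  mul_mem' ha hb P hP hu := by
    rw [map_mul]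
    exact mul_le_one' (ha P hP hu) (hb P hP hu)
  add_mem' ha hb P hP hu := P.val.map_add_le (ha P hP hu) (hb P hP hu)
  algebraMap_mem' c P _ _ := P.val_algebraMap_le_one c

variable {Q : Place F K} {u : K}

lemma eventually_pow_mul_mem_integralAbove (htr : Transcendental F u) [FiniteDimensional F⟮u⟯ K]
    (y : K) : ∀ᶠ c in Filter.atTop, u ^ c * y ∈ integralAbove Q u := by
  by_cases hy : y = 0
  · simp [hy]
  have hfin := finite_setOf_val_lt_one htr
  have := (Filter.eventually_all_finite hfin).2 fun P (hP : P.val u < 1) =>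
    P.eventually_pow_lt hP (inv_ne_zero hy)
  filter_upwards [this] with c hc P _ hPu
  have h1 := hc P hPu
  rw [map_inv₀, lt_inv_comm₀ (zero_lt_iff.2 (by
    simp only [ne_eq, map_eq_zero, pow_eq_zero_iff', not_and_or]
    exact Or.inl fun h => htr (h ▸ isAlgebraic_zero))) (zero_lt_iff.2 (by simpa using hy))] at h1
  rw [map_mul]
  calc P.val (u ^ c) * P.val y ≤ P.val (u ^ c) * (P.val (u ^ c))⁻¹ := by gcongr
    _ ≤ 1 := mul_inv_le_one

/-- There is a nonconstant element of `K` with a pole only at `Q`. -/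
lemma exists_integralOutside_not_algebraMap (hu0 : u ≠ 0) (hQ : Q.val u < 1)
    [FiniteDimensional F⟮u⟯ K] :
    ∃ a ∈ integralOutside Q, ∀ c : F, algebraMap F K c ≠ a := by
  classical
  have htr := Q.transcendental_of_val_lt_one hu0 hQ
  let O := integralAbove Q u
  have huO : u ∈ O := fun P _ h => h.le
  obtain ⟨m, hmn, b, hbO, hb, hspan⟩ := exists_linIndepMod (O := O) htr huO
  have hfin := finite_setOf_val_lt_one htr
  -- `O` allows poles at the zero `Q` of `u`, so its reduction modulo `u` cannot have full
  -- dimension.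
  have hm : m < Module.finrank F⟮u⟯ K := by
    refine lt_of_le_of_ne hmn fun hmeq => ?_
    obtain ⟨x, hx, hxT⟩ := exists_one_lt_val_forall_val_lt_one Q (hfin.toFinset.erase Q)
      (Finset.notMem_erase _ _)
    have hxO : x ∈ O := fun P hP hPu =>
      (hxT P (Finset.mem_erase.2 ⟨hP, hfin.mem_toFinset.2 hPu⟩)).le
    exact absurd (hb.val_le_one (by simp [hmeq]) htr huO hbO Q hQ hxO) (not_le.2 hx)
  obtain ⟨n, hn⟩ : ∃ n, n = Module.finrank F⟮u⟯ K := ⟨_, rfl⟩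
  obtain ⟨e, he, heint⟩ : ∃ e : Fin n → K, LinearIndependent F⟮u⟯ e ∧
      ∀ i, IsIntegral (Algebra.adjoin F {u⁻¹}) (e i) := by
    rw [hn]
    have : FiniteDimensional F⟮u⁻¹⟯ K := by rwa [adjoin_simple_inv]
    have h := exists_linearIndependent_isIntegral (F := F) u⁻¹
    rwa [adjoin_simple_inv] at h
  rw [← hn] at hm
  obtain ⟨c, hc⟩ := (Filter.eventually_all.2 fun i =>
    eventually_pow_mul_mem_integralAbove (Q := Q) htr (e i)).exists
  -- `W` has dimension `(N + 1) * n`, while `O / u ^ k O` has dimension at most `k * m ≤ (N + c) *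
  -- (n - 1)`. This choice of `N` forces the intersection of `W` with `u ^ k O` to have dimension at
  -- least 2.
  let N := c * n + 2
  let k := N + c
  let f : Fin (N + 1) × Fin n → K := fun p => u ^ (p.1 : ℕ) * (u ^ c * e p.2)
  have hf : LinearIndependent F f := linearIndependent_pow_mul htr (N + 1) c he
  let W := Submodule.span F (Set.range f)
  have hWfin : FiniteDimensional F W := FiniteDimensional.span_of_finite F (Set.finite_range f)
  have hWrank : Module.finrank F W = (N + 1) * n := by
    rw [finrank_span_eq_card hf]; simp
  have hWO : W ≤ Subalgebra.toSubmodule O := by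
    refine Submodule.span_le.2 ?_
    rintro _ ⟨p, rfl⟩
    exact O.mul_mem (O.pow_mem huO _) (hc p.2)
  obtain ⟨T, hTfin, hTrank, hTO, hT⟩ := exists_submodule_sup_pow (O := O) huO hbO hspan k
  let U := (Subalgebra.toSubmodule O).map (LinearMap.mulLeft F (u ^ k))
  have hle : W ≤ T ⊔ U := fun w hw => by
    obtain ⟨t, ht, z, hz, h⟩ := hT w (hWO hw)
    rw [h]
    exact Submodule.add_mem_sup ht ⟨z, hz, rfl⟩
  have hrank := Submodule.finrank_le_finrank_add_finrank_inf W T U hle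
  by_contra! hcon
  have hWint : ∀ w ∈ W, IsIntegral (Algebra.adjoin F {u⁻¹}) (u⁻¹ ^ k * w) := by
    intro w hw
    have hu' : IsIntegral (Algebra.adjoin F {u⁻¹}) u⁻¹ :=
      isIntegral_algebraMap (R := Algebra.adjoin F {u⁻¹})
        (x := ⟨u⁻¹, Algebra.self_mem_adjoin_singleton F u⁻¹⟩)
    induction hw using Submodule.span_induction with
    | mem w hw =>
      obtain ⟨p, rfl⟩ := hw
      have : u⁻¹ ^ k * f p = u⁻¹ ^ (N - p.1) * e p.2 := by
        have hk : k = (N - p.1) + p.1 + c := by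
          have := p.1.is_lt
          omega
        simp only [f]
        rw [hk, pow_add, pow_add]
        calc _ = u⁻¹ ^ (N - p.1) * (u⁻¹ * u) ^ (p.1 : ℕ) * (u⁻¹ * u) ^ c * e p.2 := by
              rw [mul_pow, mul_pow]
              generalize u⁻¹ = y
              ring
          _ = _ := by rw [inv_mul_cancel₀ hu0, one_pow, one_pow, mul_one, mul_one]
      rw [this]
      exact (hu'.pow _).mul (heint _)
    | zero => rw [mul_zero]; exact isIntegral_zero
    | add x y _ _ hx hy => rw [mul_add]; exact hx.add hy
    | smul a x _ hx =>
      rw [mul_smul_comm, Algebra.smul_def]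
      exact (isIntegral_algebraMap (R := Algebra.adjoin F {u⁻¹})
        (x := algebraMap F (Algebra.adjoin F {u⁻¹}) a)).mul hx
  -- If `u ^ k * a` lies in `W` with `a` in `O`, then `a` is integral over `F[u⁻¹]`, hence has no
  -- pole where `u` does not vanish; membership in `O` treats the zeros of `u` other than `Q`. Were
  -- all such `a` constant, only a line would remain.
  have hinf : W ⊓ U ≤ Submodule.span F {u ^ k} := by
    rintro w ⟨hwW, a, haO, rfl⟩
    have ha : a ∈ integralOutside Q := by
      rw [mem_integralOutside]
      intro P hP
      by_cases hPu : P.val u < 1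
      · exact haO P hP hPu
      · have h1 := hWint _ hwW
        have h2 : u⁻¹ ^ k * (LinearMap.mulLeft F (u ^ k)) a = a := by
          rw [LinearMap.mulLeft_apply, ← mul_assoc, ← mul_pow, inv_mul_cancel₀ hu0, one_pow,
            one_mul]
        rw [h2] at h1
        refine P.val_le_one_of_isIntegral (S := Algebra.adjoin F {u⁻¹}) (fun s hs => ?_) h1
        obtain ⟨q, rfl⟩ := (Algebra.adjoin_singleton_eq_range_aeval F u⁻¹).le hs
        refine P.val_aeval_le_one ?_ q
        rw [map_inv₀]
        exact inv_le_one_of_one_le₀ (not_lt.1 hPu)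
    obtain ⟨d, rfl⟩ := hcon a ha
    refine Submodule.mem_span_singleton.2 ⟨d, ?_⟩
    rw [LinearMap.mulLeft_apply, Algebra.smul_def, mul_comm]
  have h1 : Module.finrank F (W ⊓ U : Submodule F K) ≤ 1 :=
    (Submodule.finrank_mono hinf).trans (by
      simpa using finrank_span_le_card (R := F) ({u ^ k} : Set K))
  have h2 : (N + 1) * n ≤ k * m + 1 := by
    rw [← hWrank]
    omega
  have h3 : k * m ≤ k * (n - 1) := Nat.mul_le_mul_left _ (by omega)
  obtain ⟨n', hn'⟩ : ∃ n', n = n' + 1 := ⟨n - 1, by omega⟩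
  have hN : N = c * n + 2 := rfl
  have hk : k = N + c := rfl
  rw [hn', hk] at h2 h3
  rw [hn'] at hN
  rw [Nat.add_sub_cancel] at h3
  nlinarith

end Place

/-! ### The ring `A`: elements vanishing at `∞` or at `v`. -/

namespace Place

variable {F K : Type*} [Field F] [Field K] [Algebra F K]

section GlobalFacts

/-- Otherwise `a⁻¹` is transcendental and has a zero, which is a pole of `a`; there is none, at `Q`
or elsewhere. -/
lemma eq_zero_of_mem_integralOutside (hfd : ∀ u : K, Transcendental F u → FiniteDimensional F⟮u⟯ K)
    {Q : Place F K} {a : K} (ha : a ∈ integralOutside Q)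
    (hQ : Q.val a < 1) : a = 0 := by
  by_contra h0
  have htr : Transcendental F a⁻¹ := fun h =>
    Q.transcendental_of_val_lt_one h0 hQ (inv_inv a ▸ h.inv)
  have := hfd _ htr
  obtain ⟨P, hP⟩ := exists_val_lt_one_of_transcendental htr
  rw [map_inv₀, inv_lt_one₀ (zero_lt_iff.2 (by simpa using h0))] at hP
  refine absurd (mem_integralOutside.1 ha P ?_) (not_le.2 hP)
  rintro rfl
  exact lt_asymm hP hQ

lemma exists_mem_integralOutside_one_lt_val (hfd : ∀ u : K, Transcendental F u → FiniteDimensional F⟮u⟯ K)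
    {Q : Place F K} (hrat : Q.IsRational) :
    ∃ a ∈ integralOutside Q, 1 < Q.val a := by
  obtain ⟨u, hu0, hu⟩ := Q.exists_val_lt_one
  have := hfd u (Q.transcendental_of_val_lt_one hu0 hu)
  obtain ⟨a, ha, hca⟩ := exists_integralOutside_not_algebraMap hu0 hu
  refine ⟨a, ha, ?_⟩
  by_contra! hle
  obtain ⟨c, hc⟩ := hrat a hle
  refine hca c (sub_eq_zero.1 (eq_zero_of_mem_integralOutside hfd (sub_mem ha ?_) hc)).symm
  exact mem_integralOutside.2 fun P _ => P.val_algebraMap_le_one c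

/-- If all nonzero elements of `A` were `v`-units, `v` would be trivial on `F(a)` for a nonconstant
`a` in `A`, hence on its algebraic extension `K`. -/
lemma exists_mem_integralOutside_val_lt_one (hfd : ∀ u : K, Transcendental F u → FiniteDimensional F⟮u⟯ K)
    {Q v : Place F K} (hrat : Q.IsRational)
    (hv : v ≠ Q) : ∃ b ∈ integralOutside Q, b ≠ 0 ∧ v.val b < 1 := by
  obtain ⟨a, ha, hQa⟩ := exists_mem_integralOutside_one_lt_val hfd hrat
  have htr : Transcendental F a := fun halg =>
    hQa.ne' (Q.val_eq_one_of_isAlgebraic halg (by rintro rfl; simp at hQa))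
  have := hfd a htr
  have hpoly : ∀ p : F[X], aeval a p ∈ integralOutside Q := fun p =>
    mem_integralOutside.2 fun P hP => P.val_aeval_le_one (mem_integralOutside.1 ha P hP) p
  by_contra! hcon
  have hone : ∀ p : F[X], p ≠ 0 → v.val (aeval a p) = 1 := fun p hp =>
    le_antisymm (mem_integralOutside.1 (hpoly p) v hv)
      (hcon _ (hpoly p) fun h => hp (transcendental_iff.1 htr p h))
  have hL : ∀ x : F⟮a⟯, v.val (x : K) ≤ 1 := by
    rintro ⟨x, hx⟩
    obtain ⟨r, s, rfl⟩ := (mem_adjoin_simple_iff F x).1 hx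
    by_cases hs : s = 0
    · simp [hs]
    · rw [map_div₀, hone s hs, div_one]
      exact mem_integralOutside.1 (hpoly r) v hv
  obtain ⟨y, hy0, hy⟩ := v.exists_val_lt_one
  have := v.val_le_one_of_isIntegralElem (algebraMap F⟮a⟯ K) hL
    (Algebra.IsIntegral.isIntegral (R := F⟮a⟯) y⁻¹)
  rw [map_inv₀, inv_le_one₀ (zero_lt_iff.2 (by simpa using hy0))] at this
  exact absurd this (not_le.2 hy)

end GlobalFacts

/-! ### The degree filtration and monic elements. -/

section Filtration

variable {Q : Place F K} {π : Q.ring}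

lemma val_uniformizer_lt_one (hπ : Irreducible π) : Q.val (π : K) < 1 := by
  have := Q.isDVR
  rw [← ValuationSubring.valuation_lt_one_iff]
  exact hπ.not_isUnit

lemma val_le_one_of_val_mul_uniformizer_lt_one (hπ : Irreducible π) {x : K}
    (hx : Q.val (x * π) < 1) : Q.val x ≤ 1 := by
  have := Q.isDVR
  by_contra! hlt
  have hx0 : x ≠ 0 := by rintro rfl; simp at hlt
  have hinv : Q.val x⁻¹ < 1 := by
    rw [map_inv₀]
    exact inv_lt_one_of_one_lt₀ hlt
  have hmem : (⟨x⁻¹, Q.val_le_one_iff.1 hinv.le⟩ : Q.ring) ∈ IsLocalRing.maximalIdeal Q.ring :=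
    (ValuationSubring.valuation_lt_one_iff _ _).2 hinv
  rw [(IsDiscreteValuationRing.irreducible_iff_uniformizer π).1 hπ,
    Ideal.mem_span_singleton'] at hmem
  obtain ⟨y, hy⟩ := hmem
  have h1 : (y : K) * π = x⁻¹ := congrArg Subtype.val hy
  have h2 : Q.val ((y : K) * (x * π)) = 1 := by
    rw [mul_left_comm, h1, mul_inv_cancel₀ hx0, map_one]
  rw [map_mul] at h2
  exact ((mul_le_of_le_one_left zero_le (Q.ring.valuation_le_one y)).trans_lt hx).ne h2

variable (Q π) in
/-- The elements of degree `< D` of the ring of elements integral outside `Q`. -/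
def degLT (D : ℕ) : AddSubgroup K where
  carrier := {a | a ∈ integralOutside Q ∧ Q.val (a * (π : K) ^ D) < 1}
  zero_mem' := ⟨zero_mem _, by simp⟩
  add_mem' ha hb := ⟨add_mem ha.1 hb.1, by rw [add_mul]; exact Q.val.map_add_lt ha.2 hb.2⟩
  neg_mem' ha := ⟨neg_mem ha.1, by rw [neg_mul, Valuation.map_neg]; exact ha.2⟩

lemma degLT_le_succ (D : ℕ) : degLT Q π D ≤ degLT Q π (D + 1) := fun a ha => by
  refine ⟨ha.1, ?_⟩
  rw [pow_succ, ← mul_assoc, map_mul]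
  exact mul_lt_one_of_lt_of_le ha.2 (Q.ring.valuation_le_one π)

lemma sub_mem_degLT {D : ℕ} {a b : K} (ha : a ∈ monics Q π D) (hb : b ∈ monics Q π D) :
    a - b ∈ degLT Q π D := by
  refine ⟨sub_mem ha.1 hb.1, ?_⟩
  rw [show (a - b) * (π : K) ^ D = (a * (π : K) ^ D - 1) - (b * (π : K) ^ D - 1) by ring]
  exact Q.val.map_sub_lt ha.2 hb.2

lemma add_mem_monics {D : ℕ} {a b : K} (ha : a ∈ monics Q π D) (hb : b ∈ degLT Q π D) :
    a + b ∈ monics Q π D := by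
  refine ⟨add_mem ha.1 hb.1, ?_⟩
  rw [show (a + b) * (π : K) ^ D - 1 = (a * (π : K) ^ D - 1) + b * (π : K) ^ D by ring]
  exact Q.val.map_add_lt ha.2 hb.2

lemma algebraMap_mem_integralOutside (c : F) : algebraMap F K c ∈ integralOutside Q :=
  mem_integralOutside.2 fun P _ => P.val_algebraMap_le_one c

lemma val_mul_pow_of_mem_monics {D : ℕ} {a : K} (ha : a ∈ monics Q π D) :
    Q.val (a * (π : K) ^ D) = 1 := by
  rw [show a * (π : K) ^ D = 1 + (a * (π : K) ^ D - 1) by ring]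
  exact Q.val.map_one_add_of_lt ha.2

lemma algebraMap_mul_mem_degLT_succ (hπ : Irreducible π) {D : ℕ} {a : K}
    (ha : a ∈ monics Q π D) (c : F) : algebraMap F K c * a ∈ degLT Q π (D + 1) := by
  refine ⟨mul_mem (algebraMap_mem_integralOutside c) ha.1, ?_⟩
  rw [pow_succ, mul_assoc, ← mul_assoc a, map_mul, map_mul, val_mul_pow_of_mem_monics ha, one_mul]
  exact (mul_le_of_le_one_left zero_le (Q.val_algebraMap_le_one c)).trans_lt
    (val_uniformizer_lt_one hπ)

lemma algebraMap_mul_notMem_degLT {D : ℕ} {a : K} (ha : a ∈ monics Q π D) {c : F} (hc : c ≠ 0) :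
    algebraMap F K c * a ∉ degLT Q π D := fun h => by
  have := h.2
  rw [mul_assoc, map_mul, val_mul_pow_of_mem_monics ha, Q.val_algebraMap hc, one_mul] at this
  exact lt_irrefl _ this

lemma exists_eq_algebraMap_mul_of_mem_degLT_succ (hrat : Q.IsRational) (hπ : Irreducible π)
    {D : ℕ} {a : K} (ha : a ∈ degLT Q π (D + 1)) (ha' : a ∉ degLT Q π D) :
    ∃ c : F, c ≠ 0 ∧ ∃ m ∈ monics Q π D, a = algebraMap F K c * m := by
  have h1 := ha.2
  rw [pow_succ, ← mul_assoc] at h1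
  obtain ⟨c, hc⟩ := hrat _ (val_le_one_of_val_mul_uniformizer_lt_one hπ h1)
  have hc0 : c ≠ 0 := by
    rintro rfl
    rw [map_zero, sub_zero] at hc
    exact ha' ⟨ha.1, hc⟩
  have hc0' : algebraMap F K c ≠ 0 := by simpa using hc0
  refine ⟨c, hc0, algebraMap F K c⁻¹ * a,
    ⟨mul_mem (algebraMap_mem_integralOutside _) ha.1, ?_⟩, ?_⟩
  · rw [show algebraMap F K c⁻¹ * a * (π : K) ^ D - 1 =
      algebraMap F K c⁻¹ * (a * (π : K) ^ D - algebraMap F K c) by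
        rw [map_inv₀, mul_sub, inv_mul_cancel₀ hc0', mul_assoc], map_mul]
    exact (mul_le_of_le_one_left zero_le (Q.val_algebraMap_le_one _)).trans_lt hc
  · rw [map_inv₀, mul_inv_cancel_left₀ hc0']

lemma algebraMap_mul_injective {D : ℕ} {a b : K} (ha : a ∈ monics Q π D) (hb : b ∈ monics Q π D)
    {c d : F} (hc : c ≠ 0) (h : algebraMap F K c * a = algebraMap F K d * b) :
    c = d ∧ a = b := by
  have hcd : c = d := by
    by_contra hne
    have h1 : algebraMap F K (c - d) * (b * (π : K) ^ D) =
        - (algebraMap F K c * ((a - b) * (π : K) ^ D)) := by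
      rw [map_sub]
      linear_combination (π : K) ^ D * h
    have h2 := (sub_mem_degLT ha hb).2
    have h3 := congrArg Q.val h1
    rw [Valuation.map_neg, map_mul, val_mul_pow_of_mem_monics hb, map_mul,
      Q.val_algebraMap (sub_ne_zero.2 hne), Q.val_algebraMap hc, one_mul, one_mul] at h3
    exact h2.ne h3.symm
  subst hcd
  exact ⟨rfl, mul_left_cancel₀ (by simpa using hc) h⟩

lemma finite_monics_of_finite_degLT {D : ℕ} (h : (degLT Q π D : Set K).Finite) :
    (monics Q π D).Finite := by
  rcases (monics Q π D).eq_empty_or_nonempty with he | ⟨a, ha⟩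
  · rw [he]; exact Set.finite_empty
  · refine (h.image (a + ·)).subset fun b hb => ⟨b - a, sub_mem_degLT hb ha, by ring⟩

lemma finite_degLT [Finite F] (hfd : ∀ u : K, Transcendental F u → FiniteDimensional F⟮u⟯ K)
    (hrat : Q.IsRational) (hπ : Irreducible π) (D : ℕ) : (degLT Q π D : Set K).Finite := by
  induction D with
  | zero =>
    refine (Set.finite_singleton (0 : K)).subset fun a ha => ?_
    have h := ha.2
    rw [pow_zero, mul_one] at h
    exact eq_zero_of_mem_integralOutside hfd ha.1 h
  | succ D ih =>
    refine (ih.union ((Set.finite_univ (α := F)).image2 (fun c m => algebraMap F K c * m)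
      (finite_monics_of_finite_degLT ih))).subset fun a ha => ?_
    by_cases ha' : a ∈ degLT Q π D
    · exact Or.inl ha'
    · obtain ⟨c, -, m, hm, rfl⟩ := exists_eq_algebraMap_mul_of_mem_degLT_succ hrat hπ ha ha'
      exact Or.inr ⟨c, trivial, m, hm, rfl⟩

lemma finite_monics [Finite F] (hfd : ∀ u : K, Transcendental F u → FiniteDimensional F⟮u⟯ K)
    (hrat : Q.IsRational) (hπ : Irreducible π) (D : ℕ) : (monics Q π D).Finite :=
  finite_monics_of_finite_degLT (finite_degLT hfd hrat hπ D)

lemma eventually_mem_degLT (hπ : Irreducible π) {a : K} (ha : a ∈ integralOutside Q) :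
    ∀ᶠ D in Filter.atTop, a ∈ degLT Q π D := by
  by_cases ha0 : a = 0
  · simp [ha0, zero_mem]
  filter_upwards [Q.eventually_pow_lt (val_uniformizer_lt_one hπ) (inv_ne_zero ha0)] with D hD
  refine ⟨ha, ?_⟩
  rwa [map_mul, ← lt_inv_mul_iff₀ (zero_lt_iff.2 (by simpa using ha0)), mul_one, ← map_inv₀]

end Filtration

/-! ### Cancellation under translation in characteristic 2. -/

section Translation

variable (v : Place F K)

lemma val_pow_sub_pow_le {a b w : K} (ha : v.val a = 1) (hb : v.val b = 1)
    (h : v.val (a - b) ≤ v.val w) (n : ℕ) : v.val (a ^ n - b ^ n) ≤ v.val w := by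
  induction n with
  | zero => simp
  | succ n ih =>
    rw [show a ^ (n + 1) - b ^ (n + 1) = a * (a ^ n - b ^ n) + (a - b) * b ^ n by ring]
    refine v.val.map_add_le ?_ ?_
    · rwa [map_mul, ha, one_mul]
    · rwa [map_mul, map_pow, hb, one_pow, mul_one]

lemma val_inv_sub_inv_le {a b w : K} (ha : v.val a = 1) (hb : v.val b = 1)
    (h : v.val (a - b) ≤ v.val w) : v.val (a⁻¹ - b⁻¹) ≤ v.val w := by
  have ha0 : a ≠ 0 := by rintro rfl; simp at ha
  have hb0 : b ≠ 0 := by rintro rfl; simp at hb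
  rw [inv_sub_inv ha0 hb0, map_div₀, map_mul, ha, hb, mul_one, div_one, Valuation.map_sub_swap]
  exact h

lemma val_inv_zpow_sub_inv_zpow_le {a b w : K} (ha : v.val a = 1) (hb : v.val b = 1)
    (h : v.val (a - b) ≤ v.val w) (k : ℤ) : v.val ((a ^ k)⁻¹ - (b ^ k)⁻¹) ≤ v.val w := by
  obtain ⟨n, rfl | rfl⟩ := k.eq_nat_or_neg
  · rw [zpow_natCast, zpow_natCast]
    exact v.val_inv_sub_inv_le (by simp [ha]) (by simp [hb]) (v.val_pow_sub_pow_le ha hb h n)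
  · rw [zpow_neg, zpow_neg, inv_inv, inv_inv, zpow_natCast, zpow_natCast]
    exact v.val_pow_sub_pow_le ha hb h n

/-- A sum of inverse powers over a finite set of `v`-units stable under translation by `w` is
divisible by `w`, in characteristic `2`. -/
lemma val_sum_inv_zpow_le [CharP K 2] {w : K} (hw : w ≠ 0) (T : Finset K)
    (hT : ∀ a ∈ T, v.val a = 1) (hTw : ∀ a ∈ T, a + w ∈ T) (k : ℤ) :
    v.val (∑ a ∈ T, (a ^ k)⁻¹) ≤ v.val w := by
  let I := v.val.leAddSubgroup (v.val w)
  have key : QuotientAddGroup.mk' I (∑ a ∈ T, (a ^ k)⁻¹) = 0 := by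
    rw [map_sum]
    -- The involution has no fixed point as `w ≠ 0`, and paired terms agree modulo `w`, so they add
    -- up to 0 there.
    refine Finset.sum_involution (fun a _ => a + w) (fun a ha => ?_) (fun a _ _ => ?_) hTw
      (fun a _ => ?_)
    · rw [← map_add, QuotientAddGroup.mk'_apply, QuotientAddGroup.eq_zero_iff]
      change v.val _ ≤ v.val w
      rw [← CharTwo.sub_eq_add]
      refine v.val_inv_zpow_sub_inv_zpow_le (hT a ha) (hT _ (hTw a ha)) ?_ k
      rw [sub_add_cancel_left, Valuation.map_neg]
    · simpa using hw
    · rw [add_assoc, CharTwo.add_self_eq_zero, add_zero]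
  rwa [QuotientAddGroup.mk'_apply, QuotientAddGroup.eq_zero_iff] at key

lemma val_add_eq_one {a w : K} (ha : v.val a = 1) (hw : v.val w < 1) : v.val (a + w) = 1 := by
  rw [Valuation.map_add_eq_of_lt_left _ (by rwa [ha]), ha]

end Translation

/-! ### Power sums and their `v`-adic size. -/

section PowerSums

variable {Q v : Place F K} {π : Q.ring}

lemma powerSum_eq_sum {d : ℕ} (hfin : (monics Q π d).Finite) (k : ℤ) :
    powerSum Q π v d k =
      ∑ a ∈ (hfin.subset (fun a (ha : a ∈ {a | a ∈ monics Q π d ∧ v.val a = 1}) => ha.1)).toFinset,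
        (a ^ k)⁻¹ :=
  finsum_mem_eq_finite_toFinset_sum _ _

lemma val_powerSum_le_one {d : ℕ} (hfin : (monics Q π d).Finite) (k : ℤ) :
    v.val (powerSum Q π v d k) ≤ 1 := by
  rw [powerSum_eq_sum hfin]
  refine v.val_sum_le fun a ha => ?_
  rw [Set.Finite.mem_toFinset] at ha
  rw [map_inv₀, map_zpow₀, ha.2, one_zpow, inv_one]

lemma powerSum_two_mul [CharP K 2] {d : ℕ} (hfin : (monics Q π d).Finite) (k : ℤ) :
    powerSum Q π v d (2 * k) = powerSum Q π v d k ^ 2 := by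
  rw [powerSum_eq_sum hfin, powerSum_eq_sum hfin, CharTwo.sum_sq]
  refine Finset.sum_congr rfl fun a _ => ?_
  rw [mul_comm, zpow_mul, inv_pow]
  norm_cast

lemma val_powerSum_le [CharP K 2] {d : ℕ} (hfin : (monics Q π d).Finite) {w : K} (hw0 : w ≠ 0)
    (hw : v.val w < 1) (hwd : w ∈ degLT Q π d) (k : ℤ) :
    v.val (powerSum Q π v d k) ≤ v.val w := by
  rw [powerSum_eq_sum hfin]
  refine v.val_sum_inv_zpow_le hw0 _ (fun a ha => ?_) (fun a ha => ?_) k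
  · rw [Set.Finite.mem_toFinset] at ha
    exact ha.2
  · rw [Set.Finite.mem_toFinset] at ha ⊢
    exact ⟨add_mem_monics ha.1 hwd, v.val_add_eq_one ha.2 hw⟩

lemma finite_units_degLT {D : ℕ} (h : (degLT Q π D : Set K).Finite) :
    {a : K | a ∈ degLT Q π D ∧ v.val a = 1}.Finite :=
  h.subset fun _ ha => ha.1

lemma natCast_card_units [Finite F] [CharP F 2] : ((Nat.card Fˣ : ℕ) : F) = 1 := by
  have := Fintype.ofFinite F
  have h1 : ((Fintype.card F : ℕ) : F) = 0 := FiniteField.cast_card_eq_zero F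
  have h2 : Nat.card Fˣ + 1 = Fintype.card F := by
    classical
    rw [Nat.card_eq_fintype_card, Fintype.card_units]
    exact Nat.sub_add_cancel Fintype.card_pos
  rw [← h2, Nat.cast_add, Nat.cast_one] at h1
  exact CharTwo.add_eq_zero.1 h1

/-- A nonzero element of degree `< D` is uniquely a constant times a monic. Constants have `k`-th
power 1 by evenness, so each monic is counted `q - 1` times, which is 1 in `F`. The new index set,
unlike the union of the monic sets, is stable under translation. -/
lemma sum_powerSum_eq [Finite F] [CharP F 2]
    (hfd : ∀ u : K, Transcendental F u → FiniteDimensional F⟮u⟯ K)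
    (hrat : Q.IsRational) (hπ : Irreducible π) {k : ℤ} (hk : ((Nat.card F : ℤ) - 1) ∣ k)
    (D : ℕ) : ∑ d ∈ Finset.range D, powerSum Q π v d k =
      ∑ a ∈ (finite_units_degLT (v := v) (finite_degLT hfd hrat hπ D)).toFinset, (a ^ k)⁻¹ := by
  classical
  have := Fintype.ofFinite F
  induction D with
  | zero =>
    rw [Finset.sum_range_zero]
    symm
    refine Finset.sum_eq_zero fun a ha => ?_
    rw [Set.Finite.mem_toFinset] at ha
    have h := ha.1.2
    rw [pow_zero, mul_one] at h
    have h1 := eq_zero_of_mem_integralOutside hfd ha.1.1 h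
    have h2 := ha.2
    simp [h1] at h2
  | succ D ih =>
    have hfin := finite_monics hfd hrat hπ D
    set S := (hfin.subset
      (fun a (ha : a ∈ {a | a ∈ monics Q π D ∧ v.val a = 1}) => ha.1)).toFinset with hS
    have hmemS : ∀ a, a ∈ S ↔ a ∈ monics Q π D ∧ v.val a = 1 := fun a => by
      rw [hS, Set.Finite.mem_toFinset]; rfl
    have hunits : (finite_units_degLT (v := v) (finite_degLT hfd hrat hπ (D + 1))).toFinset =
        (finite_units_degLT (v := v) (finite_degLT hfd hrat hπ D)).toFinset ∪
          ((Finset.univ : Finset Fˣ) ×ˢ S).image fun p => algebraMap F K p.1 * p.2 := by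
      ext a
      simp only [Set.Finite.mem_toFinset, Finset.mem_union, Finset.mem_image, Finset.mem_product,
        Finset.mem_univ, true_and, Set.mem_ofPred_eq, hmemS, Prod.exists]
      constructor
      · rintro ⟨ha, hva⟩
        by_cases ha' : a ∈ degLT Q π D
        · exact Or.inl ⟨ha', hva⟩
        · obtain ⟨c, hc, m, hm, rfl⟩ := exists_eq_algebraMap_mul_of_mem_degLT_succ hrat hπ ha ha'
          rw [map_mul, v.val_algebraMap hc, one_mul] at hva
          exact Or.inr ⟨Units.mk0 c hc, m, ⟨hm, hva⟩, rfl⟩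
      · rintro (⟨ha, hva⟩ | ⟨c, m, ⟨hm, hvm⟩, rfl⟩)
        · exact ⟨degLT_le_succ D ha, hva⟩
        · refine ⟨algebraMap_mul_mem_degLT_succ hπ hm _, ?_⟩
          rw [map_mul, v.val_algebraMap c.ne_zero, one_mul, hvm]
    have hdisj : Disjoint (finite_units_degLT (v := v) (finite_degLT hfd hrat hπ D)).toFinset
        (((Finset.univ : Finset Fˣ) ×ˢ S).image fun p => algebraMap F K p.1 * p.2) := by
      rw [Finset.disjoint_left]
      intro a ha ha'
      rw [Set.Finite.mem_toFinset] at ha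
      obtain ⟨p, hp, rfl⟩ := Finset.mem_image.1 ha'
      exact algebraMap_mul_notMem_degLT ((hmemS _).1 (Finset.mem_product.1 hp).2).1
        p.1.ne_zero ha.1
    have hpow : ∀ c : Fˣ, (algebraMap F K c) ^ k = 1 := by
      intro c
      obtain ⟨j, rfl⟩ := hk
      have h1 : (c : F) ^ ((Nat.card F : ℤ) - 1) = 1 := by
        have h2 := FiniteField.pow_card_sub_one_eq_one (c : F) c.ne_zero
        rw [Nat.card_eq_fintype_card, ← Nat.cast_one, ← Nat.cast_sub Fintype.card_pos,
          zpow_natCast]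
        exact h2
      rw [← map_zpow₀, zpow_mul, h1, one_zpow, map_one]
    rw [Finset.sum_range_succ, ih, hunits, Finset.sum_union hdisj, powerSum_eq_sum hfin,
      Finset.sum_image, Finset.sum_product]
    · congr 1
      simp only [mul_zpow, hpow, one_mul]
      rw [Finset.sum_const, Finset.card_univ, ← Nat.card_eq_fintype_card, nsmul_eq_mul,
        ← map_natCast (algebraMap F K), natCast_card_units, map_one, one_mul]
    · intro p hp p' hp' h
      obtain ⟨h1, h2⟩ := algebraMap_mul_injective
        ((hmemS _).1 (Finset.mem_product.1 hp).2).1 ((hmemS _).1 (Finset.mem_product.1 hp').2).1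
        p.1.ne_zero h
      exact Prod.ext (Units.ext h1) h2

lemma val_sum_powerSum_le [Finite F] [CharP F 2] [CharP K 2]
    (hfd : ∀ u : K, Transcendental F u → FiniteDimensional F⟮u⟯ K)
    (hrat : Q.IsRational) (hπ : Irreducible π) {k : ℤ} (hk : ((Nat.card F : ℤ) - 1) ∣ k)
    {D : ℕ} {w : K} (hw0 : w ≠ 0) (hw : v.val w < 1) (hwd : w ∈ degLT Q π D) :
    v.val (∑ d ∈ Finset.range D, powerSum Q π v d k) ≤ v.val w := by
  rw [sum_powerSum_eq hfd hrat hπ hk]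
  refine v.val_sum_inv_zpow_le hw0 _ (fun a ha => ?_) (fun a ha => ?_) k
  · rw [Set.Finite.mem_toFinset] at ha
    exact ha.2
  · rw [Set.Finite.mem_toFinset] at ha ⊢
    exact ⟨add_mem ha.1 hwd, v.val_add_eq_one ha.2 hw⟩

/-- One high power of an element of `A` vanishing at `v` serves for all large `D`. -/
lemma eventually_exists_mem_degLT (hfd : ∀ u : K, Transcendental F u → FiniteDimensional F⟮u⟯ K)
    (hrat : Q.IsRational) (hπ : Irreducible π) (hv : v ≠ Q) {z : K} (hz : z ≠ 0) :
    ∀ᶠ D in Filter.atTop, ∃ w ∈ degLT Q π D, w ≠ 0 ∧ v.val w < 1 ∧ v.val w < v.val z := by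
  obtain ⟨b, hbA, hb0, hb⟩ := exists_mem_integralOutside_val_lt_one hfd hrat hv
  obtain ⟨m, hm, hm1⟩ :=
    ((v.eventually_pow_lt hb hz).and (Filter.eventually_ge_atTop 1)).exists
  filter_upwards [eventually_mem_degLT hπ (pow_mem hbA m)] with D hD
  refine ⟨b ^ m, hD, pow_ne_zero m hb0, ?_, hm⟩
  rw [map_pow]
  exact pow_lt_one₀ zero_le hb (by omega)

end PowerSums

end Place

end FunctionFieldPlaces

/-! ### The finite symmetric-sum identity in characteristic 2. -/

section SymmetricSums

variable {R : Type*} [CommRing R] (x : ℕ → ℤ → R)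

/-- The sum of `x d₁ a₁ ⋯ x d_r a_r` over `D > d₁ > ⋯ > d_r ≥ 0`. -/
def truncSum : ℕ → List ℤ → R
  | _, [] => 1
  | 0, _ :: _ => 0
  | D + 1, a :: t => truncSum D (a :: t) + x D a * truncSum D t

/-- The sum of `truncSum x D` over all lists with underlying multiset `m`. -/
def symSum : ℕ → Multiset ℤ → R
  | 0, m => if m = 0 then 1 else 0
  | D + 1, m => symSum D m + ∑ a ∈ m.toFinset, x D a * symSum D (m.erase a)

lemma symSum_succ (D : ℕ) (m : Multiset ℤ) :
    symSum x (D + 1) m = symSum x D m + ∑ a ∈ m.toFinset, x D a * symSum x D (m.erase a) := rfl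

lemma truncSum_nil (D : ℕ) : truncSum x D [] = 1 := by
  cases D <;> rfl

lemma mem_reorderings {l l' : List ℤ} : l' ∈ reorderings l ↔ l'.Perm l := by
  simp [reorderings]

lemma sum_reorderings_truncSum (D : ℕ) (l : List ℤ) :
    ∑ l' ∈ reorderings l, truncSum x D l' = symSum x D l := by
  induction D generalizing l with
  | zero =>
    cases l with
    | nil =>
      have : reorderings [] = {[]} := by
        ext l'
        simp [mem_reorderings]
      simp [this, truncSum_nil, symSum]
    | cons a t =>
      rw [Finset.sum_eq_zero]
      · simp [symSum]
      · intro l' hl'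
        cases l' with
        | nil => simp [mem_reorderings] at hl'
        | cons b t' => rfl
  | succ D ih =>
    -- This is the part with largest index equal to `D`; the empty list has none.
    let hd : List ℤ → R := fun l' => l'.casesOn 0 fun a t => x D a * truncSum x D t
    have hsplit : ∀ l', truncSum x (D + 1) l' = truncSum x D l' + hd l' := by
      rintro (_ | ⟨a, t⟩)
      · simp [truncSum_nil, hd]
      · rfl
    have hhd : ∑ l' ∈ reorderings l, hd l' =
        ∑ a ∈ (l : Multiset ℤ).toFinset, ∑ t ∈ reorderings (l.erase a), x D a * truncSum x D t := by
      rw [Finset.sum_sigma']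
      symm
      refine Finset.sum_of_injOn (fun p => p.1 :: p.2) ?_ ?_ ?_ ?_
      · rintro ⟨a, t⟩ _ ⟨b, t'⟩ _ h
        simp only [List.cons.injEq] at h
        obtain ⟨rfl, rfl⟩ := h
        rfl
      · rintro ⟨a, t⟩ h
        simp only [Finset.coe_sigma, Set.mem_sigma_iff, Finset.mem_coe, Multiset.mem_toFinset,
          Multiset.mem_coe, mem_reorderings] at h ⊢
        exact (h.2.cons a).trans (List.perm_cons_erase h.1).symm
      · rintro (_ | ⟨a, t⟩) hl' hnot
        · rfl
        · refine absurd ⟨⟨a, t⟩, ?_, rfl⟩ hnot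
          rw [mem_reorderings] at hl'
          simp only [Finset.coe_sigma, Set.mem_sigma_iff, Finset.mem_coe, Multiset.mem_toFinset,
            Multiset.mem_coe, mem_reorderings]
          have ha : a ∈ l := hl'.subset List.mem_cons_self
          exact ⟨ha, List.Perm.cons_inv (hl'.trans (List.perm_cons_erase ha))⟩
      · rintro ⟨a, t⟩ _
        rfl
    simp only [hsplit, Finset.sum_add_distrib, hhd, ih, symSum_succ, ← Finset.mul_sum,
      Multiset.coe_erase]

lemma Multiset.mem_erase_self_iff {m : Multiset ℤ} {a : ℤ} : a ∈ m.erase a ↔ 2 ≤ m.count a := by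
  rw [← Multiset.one_le_count_iff_mem, Multiset.count_erase_self]
  omega

lemma Multiset.mem_and_mem_erase_comm {m : Multiset ℤ} {a b : ℤ} :
    a ∈ m ∧ b ∈ m.erase a ↔ a ∈ m.erase b ∧ b ∈ m := by
  by_cases h : a = b
  · subst h
    exact and_comm
  · rw [Multiset.mem_erase_of_ne h, Multiset.mem_erase_of_ne (Ne.symm h)]

lemma sum_sum_erase_comm (f : ℤ → ℤ → R) (m : Multiset ℤ) :
    ∑ a ∈ m.toFinset, ∑ b ∈ (m.erase a).toFinset, f a b =
      ∑ b ∈ m.toFinset, ∑ a ∈ (m.erase b).toFinset, f a b :=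
  Finset.sum_comm' fun a b => by
    simpa only [Multiset.mem_toFinset] using Multiset.mem_and_mem_erase_comm

/-- In characteristic `2` the off-diagonal terms of a symmetric double sum cancel. -/
lemma sum_sum_erase_symm [CharP R 2] (f : ℤ → ℤ → R) (hf : ∀ a b, f a b = f b a)
    (m : Multiset ℤ) :
    ∑ a ∈ m.toFinset, ∑ b ∈ (m.erase a).toFinset, f a b =
      ∑ a ∈ m.toFinset with 2 ≤ m.count a, f a a := by
  have h1 : ∀ a ∈ m.toFinset, ∑ b ∈ (m.erase a).toFinset, f a b =
      (if 2 ≤ m.count a then f a a else 0) + ∑ b ∈ m.toFinset, if a = b then 0 else f a b := by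
    intro a ha
    rw [← Finset.sum_filter_add_sum_filter_not _ (fun b => b = a)]
    congr 1
    · rw [Finset.sum_filter, Finset.sum_ite_eq' (m.erase a).toFinset a]
      simp only [Multiset.mem_toFinset, Multiset.mem_erase_self_iff]
    · rw [Finset.sum_congr rfl fun b _ => (ite_not (a = b) (f a b) 0).symm, ← Finset.sum_filter]
      refine Finset.sum_congr ?_ fun _ _ => rfl
      ext b
      simp only [Finset.mem_filter, Multiset.mem_toFinset]
      refine and_congr_left_iff.2 ?_ |>.trans (and_congr_right fun _ => not_congr eq_comm)
      exact fun h => Multiset.mem_erase_of_ne h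
  rw [Finset.sum_congr rfl h1, Finset.sum_add_distrib, ← Finset.sum_filter, ← Finset.sum_product',
    add_eq_left]
  refine Finset.sum_involution (fun p _ => p.swap) ?_ ?_ ?_ ?_
  · rintro ⟨a, b⟩ _
    by_cases hab : a = b
    · simp [hab]
    · simp only [Prod.swap, hab, Ne.symm hab, if_false, hf b a]
      exact CharTwo.add_self_eq_zero _
  · rintro ⟨a, b⟩ _ h h'
    simp only [Prod.swap, Prod.mk.injEq] at h'
    simp [h'.2] at h
  · rintro ⟨a, b⟩ h
    simpa [and_comm] using h
  · rintro ⟨a, b⟩ _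
    rfl

/-- The stuffle product of a depth-one sum with a symmetric sum. The induction on `D` isolates the
terms in which the depth-one factor, the symmetric sum, or both use the index `D`. When both do,
only the squares `x D a ^ 2` survive. -/
lemma sum_symSum_erase [CharP R 2] (hx : ∀ d a, x d (2 * a) = x d a ^ 2) (D : ℕ)
    (m : Multiset ℤ) (hm : ∀ a, 2 ≤ m.count a → 2 * a ∉ m) :
    ∑ a ∈ m.toFinset, (∑ d ∈ Finset.range D, x d a) * symSum x D (m.erase a) =
      m.card * symSum x D m +
        ∑ a ∈ m.toFinset with 2 ≤ m.count a, symSum x D (2 * a ::ₘ (m.erase a).erase a) := by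
  induction D generalizing m with
  | zero =>
    by_cases h : m = 0 <;> simp [symSum, h]
  | succ D ih =>
    have hIH : ∑ b ∈ m.toFinset, x D b *
        ∑ a ∈ (m.erase b).toFinset, (∑ d ∈ Finset.range D, x d a) *
          symSum x D ((m.erase b).erase a) =
        ∑ b ∈ m.toFinset, x D b * (((m.card : R) - 1) * symSum x D (m.erase b)) +
        ∑ b ∈ m.toFinset, ∑ a ∈ (m.erase b).toFinset with 2 ≤ (m.erase b).count a,
          x D b * symSum x D (2 * a ::ₘ ((m.erase b).erase a).erase a) := by
      rw [← Finset.sum_add_distrib]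
      refine Finset.sum_congr rfl fun b hb => ?_
      rw [Multiset.mem_toFinset] at hb
      rw [ih (m.erase b) fun a ha h => hm a (ha.trans (Multiset.count_le_of_le a
        (Multiset.erase_le b m))) (Multiset.mem_of_mem_erase h), mul_add, Finset.mul_sum]
      have : ((m.erase b).card : R) = (m.card : R) - 1 := by
        rw [← Multiset.card_erase_add_one hb]
        push_cast
        ring
      rw [this]
    have hdiag := sum_sum_erase_symm
      (fun a b => x D a * (x D b * symSum x D ((m.erase a).erase b)))
      (fun a b => by rw [Multiset.erase_comm]; ring) m
    -- As `2 * a` is not in `m`, it occurs once in the merged multiset, so removing it is a separate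
    -- term; by `hx` that term is the diagonal term of `hdiag`.
    have hmerge : ∀ a ∈ m.toFinset.filter (fun a => 2 ≤ m.count a),
        symSum x (D + 1) (2 * a ::ₘ (m.erase a).erase a) =
          symSum x D (2 * a ::ₘ (m.erase a).erase a) +
          x D a * (x D a * symSum x D ((m.erase a).erase a)) +
          ∑ b ∈ ((m.erase a).erase a).toFinset,
            x D b * symSum x D (2 * a ::ₘ ((m.erase b).erase a).erase a) := by
      intro a ha
      have h2 := hm a (Finset.mem_filter.1 ha).2
      have h3 : 2 * a ∉ (m.erase a).erase a := fun h =>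
        h2 (Multiset.mem_of_mem_erase (Multiset.mem_of_mem_erase h))
      rw [symSum_succ, Multiset.toFinset_cons, Finset.sum_insert (by simpa using h3),
        Multiset.erase_cons_head, hx, add_assoc, pow_two, mul_assoc]
      congr 2
      refine Finset.sum_congr rfl fun b hb => ?_
      have hb2 : b ≠ 2 * a := fun h => h3 (h ▸ Multiset.mem_toFinset.1 hb)
      rw [Multiset.erase_cons_tail _ hb2.symm, Multiset.erase_comm _ a b,
        Multiset.erase_comm m a b]
    have hswap : ∑ a ∈ m.toFinset with 2 ≤ m.count a, ∑ b ∈ ((m.erase a).erase a).toFinset,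
          x D b * symSum x D (2 * a ::ₘ ((m.erase b).erase a).erase a) =
        ∑ b ∈ m.toFinset, ∑ a ∈ (m.erase b).toFinset with 2 ≤ (m.erase b).count a,
          x D b * symSum x D (2 * a ::ₘ ((m.erase b).erase a).erase a) := by
      refine Finset.sum_comm' fun a b => ?_
      simp only [Finset.mem_filter, Multiset.mem_toFinset, ← Multiset.one_le_count_iff_mem]
      by_cases hab : a = b
      · subst hab
        simp only [Multiset.count_erase_self]
        omega
      · rw [Multiset.count_erase_of_ne hab, Multiset.count_erase_of_ne (Ne.symm hab),
          Multiset.count_erase_of_ne (Ne.symm hab)]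
    have hexp : ∀ a, (∑ d ∈ Finset.range (D + 1), x d a) * symSum x (D + 1) (m.erase a) =
        (∑ d ∈ Finset.range D, x d a) * symSum x D (m.erase a) + x D a * symSum x D (m.erase a) +
        ∑ b ∈ (m.erase a).toFinset, (∑ d ∈ Finset.range D, x d a) *
          (x D b * symSum x D ((m.erase a).erase b)) +
        ∑ b ∈ (m.erase a).toFinset, x D a * (x D b * symSum x D ((m.erase a).erase b)) := by
      intro a
      rw [Finset.sum_range_succ, symSum_succ, ← Finset.mul_sum, ← Finset.mul_sum]
      ring
    have hcross : ∑ a ∈ m.toFinset, ∑ b ∈ (m.erase a).toFinset, (∑ d ∈ Finset.range D, x d a) *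
          (x D b * symSum x D ((m.erase a).erase b)) =
        ∑ b ∈ m.toFinset, x D b *
        ∑ a ∈ (m.erase b).toFinset, (∑ d ∈ Finset.range D, x d a) *
          symSum x D ((m.erase b).erase a) := by
      rw [sum_sum_erase_comm]
      refine Finset.sum_congr rfl fun b _ => ?_
      rw [Finset.mul_sum]
      refine Finset.sum_congr rfl fun a _ => ?_
      rw [Multiset.erase_comm]
      ring
    -- The missing copy is restored by the terms of `hexp` in which only the depth-one factor uses
    -- `D`.
    have hone : ∑ b ∈ m.toFinset, x D b * (((m.card : R) - 1) * symSum x D (m.erase b)) =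
        m.card * (∑ b ∈ m.toFinset, x D b * symSum x D (m.erase b)) -
          ∑ b ∈ m.toFinset, x D b * symSum x D (m.erase b) := by
      rw [Finset.mul_sum, ← Finset.sum_sub_distrib]
      exact Finset.sum_congr rfl fun b _ => by ring
    rw [Finset.sum_congr rfl fun a _ => hexp a, Finset.sum_congr rfl hmerge, symSum_succ x D m]
    simp only [Finset.sum_add_distrib]
    rw [hcross, hIH, hdiag, hswap, ih m hm, hone]
    ring

end SymmetricSums

/-! ### Multiplicities in the base and merged tuples. -/

section Tuples

variable {n : ℕ} (s : Fin n → ℤ) (k : Fin n → ℕ)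

lemma count_baseTuple (a : ℤ) :
    (baseTuple s k).count a = ∑ i, if s i = a then k i else 0 := by
  simp [baseTuple, List.count_flatten, List.map_ofFn, List.sum_ofFn, List.count_replicate,
    Function.comp_def]

lemma count_mergedTuple (i : Fin n) (a : ℤ) :
    (mergedTuple s k i).count a = ∑ j, if j = i then
      (if s j = a then k j - 2 else 0) + (if 2 * s j = a then 1 else 0)
      else if s j = a then k j else 0 := by
  simp only [mergedTuple, List.count_flatten, List.map_ofFn, List.sum_ofFn, Function.comp_def]
  refine Finset.sum_congr rfl fun j _ => ?_
  split_ifs <;> simp_all [List.count_replicate, List.count_append]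

variable {s}

lemma count_baseTuple_self (hs : Function.Injective s) (i : Fin n) :
    (baseTuple s k).count (s i) = k i := by
  rw [count_baseTuple, Finset.sum_eq_single i]
  · simp
  · intro j _ hj
    rw [if_neg fun h => hj (hs h)]
  · simp

variable {k}

lemma toFinset_baseTuple (hk : ∀ i, 1 ≤ k i) :
    (baseTuple s k : Multiset ℤ).toFinset = Finset.univ.image s := by
  ext a
  have h : a ∈ baseTuple s k ↔ ∃ i, a = s i := by
    simp only [baseTuple, List.mem_flatten, List.mem_ofFn]
    constructor
    · rintro ⟨_, ⟨i, rfl⟩, ha⟩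
      exact ⟨i, (List.mem_replicate.1 ha).2⟩
    · rintro ⟨i, rfl⟩
      exact ⟨_, ⟨i, rfl⟩, List.mem_replicate.2 ⟨by have := hk i; omega, rfl⟩⟩
  simp [h, eq_comm]

lemma coe_mergedTuple (hs : Function.Injective s) {i : Fin n} (hi : 1 < k i) :
    (mergedTuple s k i : Multiset ℤ) =
      2 * s i ::ₘ ((baseTuple s k : Multiset ℤ).erase (s i)).erase (s i) := by
  ext a
  -- The two removed copies are added back on the left so that no truncated subtraction remains.
  have h1 : (mergedTuple s k i).count a + (if s i = a then 2 else 0) =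
      (baseTuple s k).count a + if 2 * s i = a then 1 else 0 := by
    rw [count_mergedTuple, count_baseTuple,
      ← Finset.add_sum_erase Finset.univ _ (Finset.mem_univ i),
      ← Finset.add_sum_erase Finset.univ (fun j => if s j = a then k j else 0)
        (Finset.mem_univ i), if_pos rfl]
    have : ∑ j ∈ Finset.univ.erase i, (if j = i then
        (if s j = a then k j - 2 else 0) + (if 2 * s j = a then 1 else 0)
        else if s j = a then k j else 0) =
        ∑ j ∈ Finset.univ.erase i, if s j = a then k j else 0 :=
      Finset.sum_congr rfl fun j hj => if_neg (Finset.ne_of_mem_erase hj)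
    rw [this]
    split_ifs <;> omega
  have h2 := count_baseTuple_self k hs i
  rw [Multiset.coe_count, Multiset.count_cons]
  by_cases ha : s i = a
  · subst ha
    rw [Multiset.count_erase_self, Multiset.count_erase_self, Multiset.coe_count]
    rw [if_pos rfl] at h1
    simp only [eq_comm (a := s i)]
    omega
  · rw [Multiset.count_erase_of_ne (Ne.symm ha), Multiset.count_erase_of_ne (Ne.symm ha),
      Multiset.coe_count]
    rw [if_neg ha] at h1
    simp only [eq_comm (a := a)]
    omega

lemma length_baseTuple : (baseTuple s k).length = ∑ i, k i := by
  simp [baseTuple, List.length_flatten, List.map_ofFn, List.sum_ofFn, Function.comp_def]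

/-- The truncated form of the main relation. -/
lemma sum_reorderings_mergedTuple_add {R : Type*} [CommRing R] [CharP R 2] (x : ℕ → ℤ → R)
    (hx : ∀ d a, x d (2 * a) = x d a ^ 2) (hs : Function.Injective s) (hk : ∀ i, 1 ≤ k i)
    (hdouble : ∀ i j, 1 < k i → 2 * s i ≠ s j) (D : ℕ) :
    (∑ i with 1 < k i, ∑ l ∈ reorderings (mergedTuple s k i), truncSum x D l) +
      ((∑ i, k i : ℕ) : R) * ∑ l ∈ reorderings (baseTuple s k), truncSum x D l =
    ∑ i, (∑ d ∈ Finset.range D, x d (s i)) *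
      symSum x D ((baseTuple s k : Multiset ℤ).erase (s i)) := by
  have hinj : Set.InjOn s (Finset.univ : Finset (Fin n)) := hs.injOn
  have h := sum_symSum_erase x hx D (baseTuple s k : Multiset ℤ) fun a ha hmem => by
    have ha' : a ∈ (baseTuple s k : Multiset ℤ).toFinset := by
      rw [Multiset.mem_toFinset, ← Multiset.one_le_count_iff_mem]
      omega
    rw [← Multiset.mem_toFinset] at hmem
    rw [toFinset_baseTuple hk, Finset.mem_image] at hmem ha'
    obtain ⟨i, -, rfl⟩ := ha'
    obtain ⟨j, -, hj⟩ := hmem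
    rw [Multiset.coe_count, count_baseTuple_self k hs] at ha
    exact hdouble i j ha hj.symm
  rw [toFinset_baseTuple hk, Finset.sum_image hinj, Finset.sum_filter, Finset.sum_image hinj] at h
  rw [h, add_comm]
  congr 1
  · rw [sum_reorderings_truncSum, Multiset.coe_card, length_baseTuple]
  · rw [← Finset.sum_filter]
    simp only [Multiset.coe_count, count_baseTuple_self k hs]
    refine Finset.sum_congr rfl fun i hi => ?_
    rw [sum_reorderings_truncSum, coe_mergedTuple hs (Finset.mem_filter.1 hi).2]

end Tuples

/-! ### Truncated sums as sums over finite boxes. -/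

section Boxes

open Classical in
/-- The strictly decreasing `r`-tuples of natural numbers `< D`. -/
def strictAntiBox (D r : ℕ) : Finset (Fin r → ℕ) :=
  (Fintype.piFinset fun _ => Finset.range D).filter StrictAnti

lemma mem_strictAntiBox {D r : ℕ} {d : Fin r → ℕ} :
    d ∈ strictAntiBox D r ↔ (∀ i, d i < D) ∧ StrictAnti d := by
  simp [strictAntiBox]

lemma strictAnti_cons_iff {r D : ℕ} {d : Fin r → ℕ} :
    StrictAnti (Fin.cons D d : Fin (r + 1) → ℕ) ↔ (∀ i, d i < D) ∧ StrictAnti d := by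
  constructor
  · intro h
    exact ⟨fun i => by simpa using h (Fin.succ_pos i),
      fun i j hij => by simpa using h (Fin.succ_lt_succ_iff.2 hij)⟩
  · rintro ⟨h1, h2⟩ i j hij
    induction j using Fin.cases with
    | zero => exact absurd hij (Fin.not_lt_zero i)
    | succ j =>
      induction i using Fin.cases with
      | zero => simpa using h1 j
      | succ i => simpa using h2 (Fin.succ_lt_succ_iff.1 hij)

lemma sum_strictAntiBox_succ {R : Type*} [AddCommMonoid R] (D r : ℕ)
    (f : (Fin (r + 1) → ℕ) → R) :
    ∑ d ∈ strictAntiBox (D + 1) (r + 1), f d =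
      ∑ d ∈ strictAntiBox D (r + 1), f d + ∑ d ∈ strictAntiBox D r, f (Fin.cons D d) := by
  classical
  have hU : strictAntiBox (D + 1) (r + 1) =
      strictAntiBox D (r + 1) ∪ (strictAntiBox D r).image (Fin.cons D) := by
    ext d
    simp only [Finset.mem_union, Finset.mem_image, mem_strictAntiBox]
    constructor
    · rintro ⟨h1, h2⟩
      rcases Nat.lt_succ_iff_lt_or_eq.1 (h1 0) with h0 | h0
      · exact Or.inl ⟨fun i => (h2.antitone (Fin.zero_le i)).trans_lt h0, h2⟩
      · right
        have hd : Fin.cons D (Fin.tail d) = d := by rw [← h0]; exact Fin.cons_self_tail d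
        exact ⟨Fin.tail d, strictAnti_cons_iff.1 (hd.symm ▸ h2), hd⟩
    · rintro (⟨h1, h2⟩ | ⟨d, hd, rfl⟩)
      · exact ⟨fun i => (h1 i).trans (Nat.lt_succ_self D), h2⟩
      · refine ⟨fun i => ?_, strictAnti_cons_iff.2 hd⟩
        induction i using Fin.cases with
        | zero => simp
        | succ i => simpa using (hd.1 i).trans (Nat.lt_succ_self D)
  rw [hU, Finset.sum_union, Finset.sum_image]
  · intro d _ d' _ h
    exact Fin.cons_right_injective (α := fun _ => ℕ) D h
  · rw [Finset.disjoint_left]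
    intro d hd hd'
    obtain ⟨d', -, rfl⟩ := Finset.mem_image.1 hd'
    have := (mem_strictAntiBox.1 hd).1 0
    simp at this

lemma sum_strictAntiBox_zero {R : Type*} [AddCommMonoid R] (D : ℕ) (f : (Fin 0 → ℕ) → R) :
    ∑ d ∈ strictAntiBox D 0, f d = f default := by
  have : strictAntiBox D 0 = {default} := by
    ext d
    simp only [mem_strictAntiBox, Finset.mem_singleton]
    exact ⟨fun _ => Subsingleton.elim _ _, fun _ => ⟨fun i => i.elim0, fun i => i.elim0⟩⟩
  rw [this, Finset.sum_singleton]

lemma truncSum_eq_sum {R : Type*} [CommRing R] (x : ℕ → ℤ → R) (D : ℕ) (l : List ℤ) :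
    truncSum x D l = ∑ d ∈ strictAntiBox D l.length, ∏ j, x (d j) (l.get j) := by
  induction D generalizing l with
  | zero =>
    cases l with
    | nil => exact (sum_strictAntiBox_zero _ fun _ => 1).symm
    | cons a t =>
      symm
      refine Finset.sum_eq_zero fun d hd => ?_
      exact absurd ((mem_strictAntiBox.1 hd).1 ⟨0, Nat.succ_pos _⟩) (Nat.not_lt_zero _)
  | succ D ih =>
    cases l with
    | nil => exact (sum_strictAntiBox_zero _ fun _ => 1).symm
    | cons a t =>
      rw [truncSum, ih, ih]
      refine ((sum_strictAntiBox_succ D t.length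
        (fun d => ∏ j : Fin (t.length + 1), x (d j) ((a :: t).get j))).trans ?_).symm
      congr 1
      rw [Finset.mul_sum]
      refine Finset.sum_congr rfl fun d _ => ?_
      rw [Fin.prod_univ_succ]
      simp

end Boxes

open Filter Topology

/-! ### Summability and limits in `K_v`. -/

namespace Place

variable {F K : Type*} [Field F] [Field K] [Algebra F K] (v : Place F K)

/-- The embedding of `K` into its completion, as a ring homomorphism. -/
noncomputable def toCompletionHom : K →+* v.Completion :=
  (UniformSpace.Completion.coeRingHom (α := WithVal v.val)).comp
    (WithVal.equiv v.val).symm.toRingHom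

lemma tendsto_toCompletion_zero {ι : Type*} {l : Filter ι} {f : ι → K}
    (hf : ∀ z : K, z ≠ 0 → ∀ᶠ i in l, v.val (f i) < v.val z) :
    Tendsto (fun i => v.toCompletion (f i)) l (𝓝 0) := by
  have h0 : Tendsto (fun i => WithVal.toVal v.val (f i)) l (𝓝 0) := by
    intro U hU
    obtain ⟨γ, hγ⟩ := Valued.mem_nhds_zero.1 hU
    obtain ⟨z, hz⟩ := v.ring.valuation_surjective
      (MonoidWithZeroHom.ValueGroup₀.embedding γ.1)
    have hz0 : z ≠ 0 := by
      rintro rfl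
      rw [map_zero] at hz
      exact γ.ne_zero ((map_eq_zero _).1 hz.symm)
    refine mem_map.2 ?_
    filter_upwards [hf z hz0] with i hi
    apply hγ
    change Valued.v.restrict (WithVal.toVal v.val (f i)) < γ.1
    rw [Valuation.restrict_lt_iff_lt_embedding, ← hz]
    exact hi
  have h1 := (UniformSpace.Completion.continuous_coe (WithVal v.val)).tendsto 0
  rw [UniformSpace.Completion.coe_zero] at h1
  exact h1.comp h0

lemma nonarchimedeanRing_withVal : NonarchimedeanRing (WithVal v.val) where
  is_nonarchimedean U hU := by
    obtain ⟨γ, hγ⟩ := Valued.mem_nhds_zero.1 hU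
    let I : AddSubgroup (WithVal v.val) := Valued.v.restrict.ltAddSubgroup γ
    exact ⟨⟨I, I.isOpen_of_mem_nhds (Valued.mem_nhds_zero.2 ⟨γ, fun _ h => h⟩)⟩, hγ⟩

variable {v} {Q : Place F K} {π : Q.ring}

lemma mzvTerm_eq (l : List ℤ) (d : {d : Fin l.length → ℕ // StrictAnti d}) :
    mzvTerm Q π v l d = v.toCompletion (∏ j, powerSum Q π v (d.1 j) (l.get j)) :=
  (map_prod v.toCompletionHom _ _).symm

/-- In a nonarchimedean complete group it suffices that the terms tend to 0. All factors are
integral, so one index `≥ D` makes the term small, and only finitely many tuples have all indices `<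
D`. -/
lemma summable_mzvTerm (h1 : ∀ d k, v.val (powerSum Q π v d k) ≤ 1)
    (h0 : ∀ z : K, z ≠ 0 → ∀ᶠ d in atTop, ∀ k, v.val (powerSum Q π v d k) < v.val z)
    (l : List ℤ) : Summable (mzvTerm Q π v l) := by
  have := v.nonarchimedeanRing_withVal
  apply NonarchimedeanAddGroup.summable_of_tendsto_cofinite_zero
  simp only [funext (mzvTerm_eq l)]
  refine v.tendsto_toCompletion_zero fun z hz => ?_
  obtain ⟨D, hD⟩ := eventually_atTop.1 (h0 z hz)
  rw [eventually_cofinite]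
  refine ((strictAntiBox D l.length).finite_toSet.preimage
    Subtype.val_injective.injOn).subset fun d hd => ?_
  change d.1 ∈ strictAntiBox D l.length
  rw [mem_strictAntiBox]
  refine ⟨fun i => ?_, d.2⟩
  by_contra! hi
  apply hd
  rw [← Finset.mul_prod_erase _ _ (Finset.mem_univ i), map_mul, map_prod]
  exact (mul_le_of_le_one_right zero_le (Finset.prod_le_one' fun j _ => h1 _ _)).trans_lt
    (hD _ hi _)

lemma tendsto_sum_strictAntiBox {R : Type*} [AddCommMonoid R] [TopologicalSpace R] {r : ℕ}
    {f : (Fin r → ℕ) → R} {y : R} (h : HasSum (fun d : {d : Fin r → ℕ // StrictAnti d} => f d) y) :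
    Tendsto (fun D => ∑ d ∈ strictAntiBox D r, f d) atTop (𝓝 y) := by
  classical
  let B : ℕ → Finset {d : Fin r → ℕ // StrictAnti d} := fun D =>
    (strictAntiBox D r).subtype StrictAnti
  have hB : Tendsto B atTop atTop := by
    refine tendsto_atTop_finset_of_monotone (fun D D' hD d hd => ?_) fun d => ?_
    · rw [Finset.mem_subtype, mem_strictAntiBox] at hd ⊢
      exact ⟨fun i => (hd.1 i).trans_le hD, hd.2⟩
    · obtain ⟨D, hD⟩ := (Set.finite_range d.1).bddAbove
      refine ⟨D + 1, ?_⟩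
      rw [Finset.mem_subtype, mem_strictAntiBox]
      exact ⟨fun i => Nat.lt_succ_of_le (hD ⟨i, rfl⟩), d.2⟩
  refine (h.comp hB).congr fun D => ?_
  exact Finset.sum_subtype_of_mem f fun d hd => (mem_strictAntiBox.1 hd).2

lemma tendsto_truncSum_mzv {l : List ℤ} (h : Summable (mzvTerm Q π v l)) :
    Tendsto (fun D => v.toCompletionHom (truncSum (powerSum Q π v) D l)) atTop
      (𝓝 (mzv Q π v l)) := by
  simp only [truncSum_eq_sum, map_sum, map_prod]
  exact tendsto_sum_strictAntiBox
    (f := fun d => ∏ j, v.toCompletionHom (powerSum Q π v (d j) (l.get j))) h.hasSum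

lemma val_symSum_le_one (h1 : ∀ d k, v.val (powerSum Q π v d k) ≤ 1) (D : ℕ) (m : Multiset ℤ) :
    v.val (symSum (powerSum Q π v) D m) ≤ 1 := by
  induction D generalizing m with
  | zero =>
    rw [symSum]
    split_ifs <;> simp
  | succ D ih =>
    rw [symSum_succ]
    refine v.val.map_add_le (ih m) (v.val_sum_le fun a _ => ?_)
    rw [map_mul]
    exact mul_le_one' (h1 D a) (ih _)

end Place

theorem mainTheorem2 {Fq K : Type*} [Field Fq] [Finite Fq] [CharP Fq 2] [Field K]
    [Algebra (RatFunc Fq) K] [FunctionField Fq K] [Algebra Fq K] [IsScalarTower Fq (RatFunc Fq) K]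
    (infty : Place Fq K) (h_infty : infty.IsRational)
    (π : infty.ring) (hπ : Irreducible π)
    (v : Place Fq K) (hv : v ≠ infty)
    (n : ℕ) (hn : 1 ≤ n) (s : Fin n → ℤ) (k : Fin n → ℕ)
    (hk : ∀ i, 1 ≤ k i)
    (h_even : ∀ i, ((Nat.card Fq : ℤ) - 1) ∣ s i)
    (h_distinct : Function.Injective s)
    (h_double : ∀ i j, 1 < k i → 2 * s i ≠ s j) :
    (∀ d : ℕ, (Place.monics infty π d).Finite) ∧
    (∀ l : List ℤ, Summable (Place.mzvTerm infty π v l)) ∧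
    (∑ i with 1 < k i, ∑ l ∈ reorderings (mergedTuple s k i), Place.mzv infty π v l)
      + ((∑ i, k i : ℕ) : v.Completion) *
        (∑ l ∈ reorderings (baseTuple s k), Place.mzv infty π v l) = 0 := by
  have : CharP K 2 := charP_of_injective_algebraMap (algebraMap Fq K).injective 2
  have hfd : ∀ u : K, Transcendental Fq u →
      FiniteDimensional (IntermediateField.adjoin Fq {u}) K :=
    fun u hu => FunctionField.finiteDimensional_of_adjoin_transcendental hu
  have hfin : ∀ d, (Place.monics infty π d).Finite := Place.finite_monics hfd h_infty hπ
  have h1 : ∀ d k, v.val (Place.powerSum infty π v d k) ≤ 1 := fun d =>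
    Place.val_powerSum_le_one (hfin d)
  have h0 : ∀ z : K, z ≠ 0 →
      ∀ᶠ d in atTop, ∀ k, v.val (Place.powerSum infty π v d k) < v.val z := fun z hz => by
    filter_upwards [Place.eventually_exists_mem_degLT hfd h_infty hπ hv hz] with d
      ⟨w, hwd, hw0, hw, hwz⟩ k
    exact (Place.val_powerSum_le (hfin d) hw0 hw hwd k).trans_lt hwz
  have hsum : ∀ l : List ℤ, Summable (Place.mzvTerm infty π v l) :=
    Place.summable_mzvTerm h1 h0
  refine ⟨hfin, hsum, ?_⟩
  -- The truncated relation is passed to the limit in two ways: term by term to the zeta values, and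
  -- to 0 because each summand on the right of `sum_reorderings_mergedTuple_add` is `P_D(s i)` times
  -- an integral factor.
  refine tendsto_nhds_unique (f := fun D => v.toCompletionHom
    ((∑ i with 1 < k i, ∑ l ∈ reorderings (mergedTuple s k i),
        truncSum (Place.powerSum infty π v) D l) +
      ((∑ i, k i : ℕ) : K) * ∑ l ∈ reorderings (baseTuple s k),
        truncSum (Place.powerSum infty π v) D l)) (l := atTop) ?_ ?_
  · simp only [map_add, map_mul, map_sum, map_natCast]
    exact (tendsto_finsetSum _ fun i _ => tendsto_finsetSum _ fun l _ =>
      Place.tendsto_truncSum_mzv (hsum l)).add (tendsto_const_nhds.mul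
        (tendsto_finsetSum _ fun l _ => Place.tendsto_truncSum_mzv (hsum l)))
  · refine v.tendsto_toCompletion_zero fun z hz => ?_
    filter_upwards [Place.eventually_exists_mem_degLT hfd h_infty hπ hv hz] with D
      ⟨w, hwD, hw0, hw, hwz⟩
    rw [sum_reorderings_mergedTuple_add _ (fun d a => Place.powerSum_two_mul (hfin d) a)
      h_distinct hk h_double]
    refine (v.val_sum_le fun i _ => ?_).trans_lt hwz
    rw [map_mul]
    exact (mul_le_of_le_one_right zero_le (Place.val_symSum_le_one h1 D _)).trans
      (Place.val_sum_powerSum_le hfd h_infty hπ (h_even i) hw0 hw hwD)
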